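/- **Conventions.** Let $M$ be a smooth manifold. For a field $J$ of endomorphisms of $TM$ and an $n$-form $\alpha$ put $(J\alpha)(X_1,\dots,X_n)=(-1)^n\alpha(JX_1,\dots,JX_n)$, and let $d$ be the exterior derivative without normalization factor ($d\alpha(X,Y)=X\alpha(Y)-Y\alpha(X)-\alpha([X,Y])$ for $1$-forms). A hypercomplex structure is a triple of integrable complex structures $I_1,I_2,I_3$ on $M$ with $I_1I_2=I_3=-I_2I_1$; a Riemannian metric $g$ is hyper-Hermitian if $g(I_aX,I_aY)=g(X,Y)$ for $a=1,2,3$, and then $F_a(X,Y)=g(I_aX,Y)$ are the Kähler forms. On $n$-forms put $d_a=(-1)^nI_a\,d\,I_a$, $\partial_a=\frac12(d+i\,d_a)$, $\bar\partial_a=\frac12(d-i\,d_a)$. An HKT-connection is a linear connection $\nabla$ with $\nabla g=0$, $\nabla I_1=\nabla I_2=\nabla I_3=0$ whose torsion tensor $c(X,Y,Z)=g(X,T(Y,Z))$, where $T(Y,Z)=\nabla_YZ-\nabla_ZY-[Y,Z]$, is totally skew-symmetric. $(M,I_1,I_2,I_3,g)$ is an HKT-structure if it is hyper-Hermitian and admits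 an HKT-connection. **Theorem.** Let $(M,I_1,I_2,I_3,g)$ be an HKT-structure, $U\subseteq M$ an open set, and $\mu$ a real-valued function that is smooth on $U$, such that on $U$ $$F_2+iF_3=2\,\partial_1 I_2\bar\partial_1\mu .$$ Then $\mu$ is a potential function for the HKT-structure on $U$, that is, on $U$ $$F_1=\tfrac12(dd_1+d_2d_3)\mu,\qquad F_2=\tfrac12(dd_2+d_3d_1)\mu,\qquad F_3=\tfrac12(dd_3+d_1d_2)\mu .$$ Moreover, on $U$ $$d_1F_1=d_2F_2=d_3F_3=\tfrac12\,d_1d_2d_3\mu ,$$ and the torsion tensor of every HKT-connection of the structure is $c=-\tfrac12\,d_1d_2d_3\mu$ on $U$. -/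

import Mathlib

open Bundle Manifold
open scoped ContDiff

noncomputable section HKT

variable {E : Type*} [NormedAddCommGroup E] [NormedSpace ℝ E]
  {M : Type*} [TopologicalSpace M] [ChartedSpace E M]
  {F : Type*} [NormedAddCommGroup F] [NormedSpace ℝ F]

/-! ### Differential forms on a manifold -/

/-- A (not necessarily smooth) field of `n`-forms on `M`, with values in `F`. -/
abbrev FormField (E M F : Type*) [NormedAddCommGroup E] [NormedSpace ℝ E]
    [TopologicalSpace M] [ChartedSpace E M] [NormedAddCommGroup F] [NormedSpace ℝ F]
    (n : ℕ) : Type _ :=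
  (x : M) → (TangentSpace 𝓘(ℝ, E) x) [⋀^Fin n]→L[ℝ] F

/-- A field of endomorphisms of the tangent spaces of `M`. -/
abbrev EndoField (E M : Type*) [NormedAddCommGroup E] [NormedSpace ℝ E]
    [TopologicalSpace M] [ChartedSpace E M] : Type _ :=
  (x : M) → TangentSpace 𝓘(ℝ, E) x →L[ℝ] TangentSpace 𝓘(ℝ, E) x

/-- A function, seen as a `0`-form. -/
def FormField.ofFun (E : Type*) [NormedAddCommGroup E] [NormedSpace ℝ E] [ChartedSpace E M]
    (f : M → F) : FormField E M F 0 :=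
  fun x ↦ ContinuousAlternatingMap.constOfIsEmpty ℝ (TangentSpace 𝓘(ℝ, E) x) (Fin 0) (f x)

namespace FormField

/-- The exterior derivative: `(dα)_x` is computed in the preferred chart at `x`, that is, `α` is
pulled back to the model space by the inverse of the chart, differentiated there, and the result
is pulled back to `T_x M` by the chart. No normalization factor is used:
`dα (X, Y) = X (α Y) - Y (α X) - α [X, Y]` on `1`-forms, and similarly in all degrees. -/
def d {n : ℕ} (α : FormField E M F n) : FormField E M F (n + 1) :=
  fun x ↦
    (extDeriv (fun y : E ↦ (α ((extChartAt 𝓘(ℝ, E) x).symm y)).compContinuousLinearMap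
        (mfderiv 𝓘(ℝ, E) 𝓘(ℝ, E) (extChartAt 𝓘(ℝ, E) x).symm y))
      (extChartAt 𝓘(ℝ, E) x x)).compContinuousLinearMap
        (mfderiv 𝓘(ℝ, E) 𝓘(ℝ, E) (extChartAt 𝓘(ℝ, E) x) x)

/-- The action of an endomorphism field on `n`-forms,
`(Jα)(X₁, …, Xₙ) = (-1)ⁿ α(JX₁, …, JXₙ)`. -/
def act {n : ℕ} (J : EndoField E M) (α : FormField E M F n) : FormField E M F n :=
  fun x ↦ (-1 : ℝ) ^ n • (α x).compContinuousLinearMap (J x)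

/-- The operator `d^c = (-1)ⁿ J d J` on `n`-forms. -/
def dc {n : ℕ} (J : EndoField E M) (α : FormField E M F n) : FormField E M F (n + 1) :=
  (-1 : ℝ) ^ n • act J (d (act J α))

/-- The operator `∂ = (d + i d^c) / 2` on complex-valued forms. -/
def del {n : ℕ} (J : EndoField E M) (α : FormField E M ℂ n) : FormField E M ℂ (n + 1) :=
  (1 / 2 : ℂ) • (d α + Complex.I • dc J α)

/-- The operator `∂̄ = (d - i d^c) / 2` on complex-valued forms. -/
def delBar {n : ℕ} (J : EndoField E M) (α : FormField E M ℂ n) : FormField E M ℂ (n + 1) :=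
  (1 / 2 : ℂ) • (d α - Complex.I • dc J α)

/-- A real form, seen as a complex-valued form. -/
def toComplex {n : ℕ} (α : FormField E M ℝ n) : FormField E M ℂ n :=
  fun x ↦ Complex.ofRealCLM.compContinuousAlternatingMap (α x)

end FormField

/-! ### Hypercomplex and hyper-Hermitian structures -/

variable [IsManifold 𝓘(ℝ, E) ∞ M]

/-- `J` is an integrable complex structure: it is smooth, it squares to `-1` and its Nijenhuis
tensor vanishes. -/
structure IsComplexStructure (J : EndoField E M) : Prop where
  smooth : ContMDiff 𝓘(ℝ, E) (𝓘(ℝ, E).prod 𝓘(ℝ, E →L[ℝ] E)) ∞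
    (fun x ↦ TotalSpace.mk' (E →L[ℝ] E)
      (E := fun x : M ↦ TangentSpace 𝓘(ℝ, E) x →L[ℝ] TangentSpace 𝓘(ℝ, E) x) x (J x))
  sq : ∀ x v, J x (J x v) = -v
  nijenhuis : ∀ (x : M) (X Y : (y : M) → TangentSpace 𝓘(ℝ, E) y),
    ContMDiffAt 𝓘(ℝ, E) 𝓘(ℝ, E).tangent ∞ (fun y ↦ (X y : TangentBundle 𝓘(ℝ, E) M)) x →
    ContMDiffAt 𝓘(ℝ, E) 𝓘(ℝ, E).tangent ∞ (fun y ↦ (Y y : TangentBundle 𝓘(ℝ, E) M)) x →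
    VectorField.mlieBracket 𝓘(ℝ, E) (fun y ↦ J y (X y)) (fun y ↦ J y (Y y)) x
      - J x (VectorField.mlieBracket 𝓘(ℝ, E) (fun y ↦ J y (X y)) Y x)
      - J x (VectorField.mlieBracket 𝓘(ℝ, E) X (fun y ↦ J y (Y y)) x)
      - VectorField.mlieBracket 𝓘(ℝ, E) X Y x = 0

/-- Three integrable complex structures with `I₁ I₂ = I₃ = - I₂ I₁`. -/
structure IsHypercomplex (I₁ I₂ I₃ : EndoField E M) : Prop where
  complex₁ : IsComplexStructure I₁
  complex₂ : IsComplexStructure I₂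
  complex₃ : IsComplexStructure I₃
  mul₁₂ : ∀ x v, I₁ x (I₂ x v) = I₃ x v
  mul₂₁ : ∀ x v, I₂ x (I₁ x v) = -I₃ x v

/-- Smooth Riemannian metrics on the manifold `M`. -/
abbrev RiemMetric (E M : Type*) [NormedAddCommGroup E] [NormedSpace ℝ E]
    [TopologicalSpace M] [ChartedSpace E M] [IsManifold 𝓘(ℝ, E) ∞ M] : Type _ :=
  ContMDiffRiemannianMetric 𝓘(ℝ, E) ∞ E (TangentSpace 𝓘(ℝ, E) : M → Type _)

/-- `J` squares to `-1` and is orthogonal for the metric `g`. -/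
structure IsHermitian (g : RiemMetric E M) (J : EndoField E M) : Prop where
  sq : ∀ x v, J x (J x v) = -v
  inner_map : ∀ x v w, g.inner x (J x v) (J x w) = g.inner x v w

/-- The Kähler form `F(X, Y) = g(JX, Y)`. -/
def kahlerForm (g : RiemMetric E M) (J : EndoField E M) (hJ : IsHermitian g J) :
    FormField E M ℝ 2 :=
  fun x ↦
    { toFun := fun v ↦ g.inner x (J x (v 0)) (v 1)
      map_update_add' := by
        intro _ v i a b
        fin_cases i <;> simp
      map_update_smul' := by
        intro _ v i a b
        fin_cases i <;> simp
      cont := by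
        let B : E →L[ℝ] E →L[ℝ] ℝ := g.inner x
        let A : E →L[ℝ] E := J x
        change Continuous fun v : Fin 2 → E ↦ B (A (v 0)) (v 1)
        fun_prop
      map_eq_zero_of_eq' := by
        intro v i j hij hne
        have h01 : v 0 = v 1 := by
          fin_cases i <;> fin_cases j <;> simp_all
        have h := hJ.inner_map x (J x (v 1)) (v 1)
        rw [hJ.sq, map_neg, neg_apply, g.symm] at h
        change g.inner x (J x (v 0)) (v 1) = 0
        rw [h01]
        linarith }

/-- A hyper-Hermitian structure: a hypercomplex structure and a Riemannian metric for which the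
three complex structures are orthogonal. -/
structure IsHyperHermitian (g : RiemMetric E M) (I₁ I₂ I₃ : EndoField E M) : Prop
    extends IsHypercomplex I₁ I₂ I₃ where
  hermitian₁ : IsHermitian g I₁
  hermitian₂ : IsHermitian g I₂
  hermitian₃ : IsHermitian g I₃

/-! ### Hyper-Kähler connections with torsion -/

/-- Linear connections on the manifold `M`; `cov Y x v` is `∇_v Y` at the point `x`. -/
abbrev LinConnection (E M : Type*) [NormedAddCommGroup E] [NormedSpace ℝ E]
    [TopologicalSpace M] [ChartedSpace E M] [IsManifold 𝓘(ℝ, E) ∞ M] : Type _ :=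
  CovariantDerivative 𝓘(ℝ, E) E (TangentSpace 𝓘(ℝ, E) : M → Type _)

/-- The vector field `Y` is differentiable at `x`. -/
abbrev FieldDiffAt (Y : (y : M) → TangentSpace 𝓘(ℝ, E) y) (x : M) : Prop :=
  MDifferentiableAt 𝓘(ℝ, E) 𝓘(ℝ, E).tangent (fun y ↦ (Y y : TangentBundle 𝓘(ℝ, E) M)) x

/-- The metric is parallel: `v (g(Y, Z)) = g(∇_v Y, Z) + g(Y, ∇_v Z)`. -/
def IsMetricConnection (g : RiemMetric E M) (cov : LinConnection E M) : Prop :=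
  ∀ (x : M) (Y Z : (y : M) → TangentSpace 𝓘(ℝ, E) y) (v : TangentSpace 𝓘(ℝ, E) x),
    FieldDiffAt Y x → FieldDiffAt Z x →
    mfderiv 𝓘(ℝ, E) 𝓘(ℝ, ℝ) (fun y ↦ g.inner y (Y y) (Z y)) x v =
      g.inner x (cov Y x v) (Z x) + g.inner x (Y x) (cov Z x v)

/-- The endomorphism field `J` is parallel: `∇_v (J Y) = J (∇_v Y)`. -/
def IsParallel (cov : LinConnection E M) (J : EndoField E M) : Prop :=
  ∀ (x : M) (Y : (y : M) → TangentSpace 𝓘(ℝ, E) y) (v : TangentSpace 𝓘(ℝ, E) x),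
    FieldDiffAt Y x → cov (fun y ↦ J y (Y y)) x v = J x (cov Y x v)

variable [FiniteDimensional ℝ E] [CompleteSpace E]

/-- The torsion `T(Y, Z) = ∇_Y Z - ∇_Z Y - [Y, Z]` as a covariant tensor,
`c(X, Y, Z) = g(X, T(Y, Z))`. -/
def torsionTensor (g : RiemMetric E M) (cov : LinConnection E M) (x : M)
    (X Y Z : TangentSpace 𝓘(ℝ, E) x) : ℝ :=
  g.inner x X (cov.torsion x Y Z)

/-- A hyper-Kähler connection (with torsion), or HKT-connection: a smooth linear connection that
preserves the metric and the three complex structures, and whose torsion tensor is totally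
skew-symmetric. -/
structure IsHKTConnection (g : RiemMetric E M) (I₁ I₂ I₃ : EndoField E M)
    (cov : LinConnection E M) : Prop where
  smooth : CovariantDerivative.ContMDiffCovariantDerivative cov ∞
  metric : IsMetricConnection g cov
  parallel₁ : IsParallel cov I₁
  parallel₂ : IsParallel cov I₂
  parallel₃ : IsParallel cov I₃
  skew₁₂ : ∀ x X Y Z, torsionTensor g cov x X Y Z = -torsionTensor g cov x Y X Z
  skew₂₃ : ∀ x X Y Z, torsionTensor g cov x X Y Z = -torsionTensor g cov x X Z Y

/-- An HKT-structure: a hyper-Hermitian structure that admits an HKT-connection. -/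
structure IsHKT (g : RiemMetric E M) (I₁ I₂ I₃ : EndoField E M) : Prop
    extends IsHyperHermitian g I₁ I₂ I₃ where
  exists_connection : ∃ cov : LinConnection E M, IsHKTConnection g I₁ I₂ I₃ cov

/-- The function `μ` is, on the set `U`, a potential function of the HKT-structure. -/
def IsHKTPotentialOn (g : RiemMetric E M) (I₁ I₂ I₃ : EndoField E M)
    (h : IsHKT g I₁ I₂ I₃) (U : Set M) (μ : M → ℝ) : Prop :=
  ∀ x ∈ U,
    kahlerForm g I₁ h.hermitian₁ x =
      (1 / 2 : ℝ) • ((FormField.dc I₁ (FormField.ofFun E μ)).d + FormField.dc I₂ (FormField.dc I₃ (FormField.ofFun E μ))) x ∧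
    kahlerForm g I₂ h.hermitian₂ x =
      (1 / 2 : ℝ) • ((FormField.dc I₂ (FormField.ofFun E μ)).d + FormField.dc I₃ (FormField.dc I₁ (FormField.ofFun E μ))) x ∧
    kahlerForm g I₃ h.hermitian₃ x =
      (1 / 2 : ℝ) • ((FormField.dc I₃ (FormField.ofFun E μ)).d + FormField.dc I₁ (FormField.dc I₂ (FormField.ofFun E μ))) x

end HKT

/-! ### Differential forms and their exterior derivative in charts -/

noncomputable section HKTProof

open Set Filter Topology

variable {E : Type*} [NormedAddCommGroup E] [NormedSpace ℝ E]
  {M : Type*} [TopologicalSpace M] [ChartedSpace E M]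
  {F : Type*} [NormedAddCommGroup F] [NormedSpace ℝ F]

/-! Fix an HKT-connection with torsion `T`. At a point, in the preferred chart, the derivatives of
the metric and of the complex structures are expressions in the Christoffel symbols
(`IsParallel.fderiv_chartRep`, `IsMetricConnection.fderiv_metricRep`), and integrability of a
parallel `J` becomes the algebraic identity T(Ju,Jv) = J T(Ju,v) + J T(u,Jv) + T(u,v)
(`IsComplexStructure.torsion_map_map`). With the covariant Hessian H of μ, the form B_a = d d_a μ is
B_a(u,v) = -H(u,I_a v) + H(v,I_a u) - dμ(I_a T(u,v)) (`d_dc_ofFun_apply`), and the skew part of H is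
governed by dμ ∘ T (`hessian_sub_swap`). The potential formulas are then linear algebra on one
tangent space.

Two consequences carry it: B_a is I_a-invariant (`QuaternionicTorsion.twisted_map_map`), and B_2(I_3
X,Y) + B_2(X,I_3 Y) = B_1(X,Y) - B_1(I_2 X,I_2 Y) (`QuaternionicTorsion.twisted_add`). The
hypothesis splits into F_a = ½(B_a - B_a(I_1·,I_1·)) for a = 2, 3 (`kahlerForm_re_im`). The mixed
terms are d_2 d_3 μ = -B_1(I_2·,I_2·) and its analogues, so F_3 is immediate and F_2 follows by
I_2-invariance of B_2. Finally F_1 = F_2(I_3·,·) is turned into B_1 by the second identity.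

For the torsion, ∇F_a = 0 together with the integrability identity and skewness of c gives d_a F_a =
-c for every a (`dc_kahlerForm_apply`). Applying d_1 to d_2 d_3 μ = 2 F_1 - d d_1 μ kills the last
term, because d d_1 μ is I_1-invariant and closed; hence d_1 d_2 d_3 μ = 2 d_1 F_1
(`dc_dc_dc_ofFun_apply`). -/

/-- The derivative at `y` of the preferred chart at `x`. -/
def chartD (E : Type*) [NormedAddCommGroup E] [NormedSpace ℝ E] {M : Type*} [TopologicalSpace M]
    [ChartedSpace E M] (x y : M) : E →L[ℝ] E :=
  mfderiv 𝓘(ℝ, E) 𝓘(ℝ, E) (extChartAt 𝓘(ℝ, E) x) y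

/-- The derivative at `e` of the inverse of the preferred chart at `x`. -/
def chartDSymm {E : Type*} [NormedAddCommGroup E] [NormedSpace ℝ E] {M : Type*}
    [TopologicalSpace M] [ChartedSpace E M] (x : M) (e : E) : E →L[ℝ] E :=
  mfderiv 𝓘(ℝ, E) 𝓘(ℝ, E) (extChartAt 𝓘(ℝ, E) x).symm e

/-- The expression of a form in the preferred chart at `x`. -/
def FormField.chartRep {n : ℕ} (α : FormField E M F n) (x : M) : E → E [⋀^Fin n]→L[ℝ] F :=
  fun e ↦ ContinuousAlternatingMap.compContinuousLinearMap (M := E)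
    (α ((extChartAt 𝓘(ℝ, E) x).symm e)) (chartDSymm x e)

/-- The value of a form at a point, as a form on the model space. -/
def FormField.at {n : ℕ} (α : FormField E M F n) (x : M) : E [⋀^Fin n]→L[ℝ] F := α x

theorem minSmoothness_two_le : minSmoothness ℝ 2 ≤ (∞ : WithTop ℕ∞) := by
  rw [minSmoothness_of_isRCLikeNormedField]; norm_cast

section Charts

variable [IsManifold 𝓘(ℝ, E) ∞ M]

theorem isManifold_one : IsManifold 𝓘(ℝ, E) 1 M := .of_le (n := ∞) (by norm_cast)

theorem mdifferentiableAt_extChartAt_symm {x : M} {e : E}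
    (he : e ∈ (extChartAt 𝓘(ℝ, E) x).target) :
    MDifferentiableAt 𝓘(ℝ, E) 𝓘(ℝ, E) (extChartAt 𝓘(ℝ, E) x).symm e := by
  have := isManifold_one (E := E) (M := M)
  simpa [mdifferentiableWithinAt_univ] using mdifferentiableWithinAt_extChartAt_symm he

theorem chartD_comp_chartDSymm {x : M} {e : E} (he : e ∈ (extChartAt 𝓘(ℝ, E) x).target) :
    chartD E x ((extChartAt 𝓘(ℝ, E) x).symm e) ∘L chartDSymm x e = .id ℝ E := by
  have := isManifold_one (E := E) (M := M)
  have h := mfderiv_extChartAt_comp_mfderivWithin_extChartAt_symm he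
  rw [modelWithCornersSelf_coe, range_id, mfderivWithin_univ] at h
  exact h

theorem chartDSymm_comp_chartD {x y : M} (hy : y ∈ (extChartAt 𝓘(ℝ, E) x).source) :
    chartDSymm x (extChartAt 𝓘(ℝ, E) x y) ∘L chartD E x y = .id ℝ E := by
  have := isManifold_one (E := E) (M := M)
  have h := mfderivWithin_extChartAt_symm_comp_mfderiv_extChartAt' hy
  rw [modelWithCornersSelf_coe, range_id, mfderivWithin_univ] at h
  exact h

/-- The tangent space at `x` is the model space through this very chart, so pointwise values at `x`
need no conversion. -/
theorem chartD_self (x : M) : chartD E x x = .id ℝ E := by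
  have := isManifold_one (E := E) (M := M)
  exact mfderiv_extChartAt_self

theorem chartDSymm_self (x : M) : chartDSymm x (extChartAt 𝓘(ℝ, E) x x) = .id ℝ E := by
  have h := chartDSymm_comp_chartD (mem_extChartAt_source (I := 𝓘(ℝ, E)) x)
  rwa [chartD_self, ContinuousLinearMap.comp_id] at h

theorem contDiffAt_coordChange {x y : M} {e : E} (he : e ∈ (extChartAt 𝓘(ℝ, E) y).target)
    (hx : (extChartAt 𝓘(ℝ, E) y).symm e ∈ (extChartAt 𝓘(ℝ, E) x).source) :
    ContDiffAt ℝ ∞ (extChartAt 𝓘(ℝ, E) x ∘ (extChartAt 𝓘(ℝ, E) y).symm) e := by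
  rw [← contMDiffAt_iff_contDiffAt]
  refine ContMDiffAt.comp e (contMDiffAt_extChartAt' (by simpa using hx)) ?_
  exact (contMDiffOn_extChartAt_symm y).contMDiffAt ((isOpen_extChartAt_target y).mem_nhds he)

theorem fderiv_coordChange {x y : M} {e : E} (he : e ∈ (extChartAt 𝓘(ℝ, E) y).target)
    (hx : (extChartAt 𝓘(ℝ, E) y).symm e ∈ (extChartAt 𝓘(ℝ, E) x).source) :
    fderiv ℝ (extChartAt 𝓘(ℝ, E) x ∘ (extChartAt 𝓘(ℝ, E) y).symm) e =
      chartD E x ((extChartAt 𝓘(ℝ, E) y).symm e) ∘L chartDSymm y e := by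
  have := isManifold_one (E := E) (M := M)
  rw [← mfderiv_eq_fderiv]
  exact mfderiv_comp e (mdifferentiableAt_extChartAt (by simpa using hx))
    (mdifferentiableAt_extChartAt_symm he)

end Charts

namespace FormField

variable {n : ℕ}

theorem d_def (α : FormField E M F n) (x : M) :
    α.d.at x = (extDeriv (α.chartRep x) (extChartAt 𝓘(ℝ, E) x x)).compContinuousLinearMap
      (chartD E x x) := rfl

section

variable [IsManifold 𝓘(ℝ, E) ∞ M]

theorem d_eq_extDeriv (α : FormField E M F n) (x : M) :
    α.d.at x = extDeriv (α.chartRep x) (extChartAt 𝓘(ℝ, E) x x) := by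
  rw [d_def, chartD_self]; rfl

omit [IsManifold 𝓘(ℝ, E) ∞ M] in
theorem tendsto_extChartAt_symm (x : M) :
    Tendsto (extChartAt 𝓘(ℝ, E) x).symm (𝓝 (extChartAt 𝓘(ℝ, E) x x)) (𝓝 x) := by
  have := (continuousAt_extChartAt_symm (I := 𝓘(ℝ, E)) x).tendsto
  rwa [extChartAt_to_inv] at this

omit [IsManifold 𝓘(ℝ, E) ∞ M] in
theorem chartRep_congr {α β : FormField E M F n} {x : M} {e : E}
    (h : α.at ((extChartAt 𝓘(ℝ, E) x).symm e) = β.at ((extChartAt 𝓘(ℝ, E) x).symm e)) :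
    α.chartRep x e = β.chartRep x e := 
  congrArg (fun γ : E [⋀^Fin n]→L[ℝ] F ↦ γ.compContinuousLinearMap (chartDSymm x e)) h

theorem d_congr {α β : FormField E M F n} {x : M} (h : ∀ᶠ y in 𝓝 x, α y = β y) :
    α.d x = β.d x := by
  change α.d.at x = β.d.at x
  rw [d_eq_extDeriv, d_eq_extDeriv]
  apply Filter.EventuallyEq.extDeriv_eq
  filter_upwards [(tendsto_extChartAt_symm x).eventually h] with e he
  exact chartRep_congr he

theorem d_add {α β : FormField E M F n} {x : M}
    (hα : DifferentiableAt ℝ (α.chartRep x) (extChartAt 𝓘(ℝ, E) x x))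
    (hβ : DifferentiableAt ℝ (β.chartRep x) (extChartAt 𝓘(ℝ, E) x x)) :
    (α + β).d x = α.d x + β.d x := by
  change (α + β).d.at x = α.d.at x + β.d.at x
  simp only [d_eq_extDeriv]
  exact extDeriv_add hα hβ

theorem d_smul (c : ℝ) (α : FormField E M F n) (x : M) : (c • α).d x = c • α.d x := by
  change (c • α).d.at x = c • α.d.at x
  simp only [d_eq_extDeriv]
  exact extDeriv_smul c (α.chartRep x)

/-- The expression of a form in another chart. -/
theorem chartRep_coordChange (α : FormField E M F n) {x y : M} {e : E}
    (he : e ∈ (extChartAt 𝓘(ℝ, E) y).target)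
    (hx : (extChartAt 𝓘(ℝ, E) y).symm e ∈ (extChartAt 𝓘(ℝ, E) x).source) :
    α.chartRep y e =
      (α.chartRep x ((extChartAt 𝓘(ℝ, E) x ∘ (extChartAt 𝓘(ℝ, E) y).symm) e)).compContinuousLinearMap
        (fderiv ℝ (extChartAt 𝓘(ℝ, E) x ∘ (extChartAt 𝓘(ℝ, E) y).symm) e) := by
  rw [fderiv_coordChange he hx]
  have h := chartDSymm_comp_chartD hx
  have h2 := (extChartAt 𝓘(ℝ, E) x).left_inv hx
  ext v
  change α.at _ _ = α.at _ _
  rw [Function.comp_apply, h2]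
  congr 1
  funext i
  exact (congrArg (fun L : E →L[ℝ] E ↦ L (chartDSymm y e (v i))) h).symm

/-- The exterior derivative is computed by any chart. -/
theorem chartRep_d (α : FormField E M F n) {x : M} {e : E}
    (he : e ∈ (extChartAt 𝓘(ℝ, E) x).target) (hα : DifferentiableAt ℝ (α.chartRep x) e) :
    α.d.chartRep x e = extDeriv (α.chartRep x) e := by
  set y := (extChartAt 𝓘(ℝ, E) x).symm e with hy
  have hyx : y ∈ (extChartAt 𝓘(ℝ, E) x).source := (extChartAt 𝓘(ℝ, E) x).map_target he
  have hyy : (extChartAt 𝓘(ℝ, E) y).symm (extChartAt 𝓘(ℝ, E) y y) = y := extChartAt_to_inv y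
  have hyt := mem_extChartAt_target (I := 𝓘(ℝ, E)) y
  have hfe : (extChartAt 𝓘(ℝ, E) x ∘ (extChartAt 𝓘(ℝ, E) y).symm) (extChartAt 𝓘(ℝ, E) y y) = e := by
    rw [Function.comp_apply, hyy, hy, (extChartAt 𝓘(ℝ, E) x).right_inv he]
  -- By definition the derivative at `y` uses the chart at `y`; naturality of `extDeriv` under the
  -- coordinate change moves it to the chart at `x`.
  have key : α.d.at y = (extDeriv (α.chartRep x) e).compContinuousLinearMap (chartD E x y) := by
    rw [d_eq_extDeriv]
    have h1 : α.chartRep y =ᶠ[𝓝 (extChartAt 𝓘(ℝ, E) y y)] fun e' ↦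
      (α.chartRep x ((extChartAt 𝓘(ℝ, E) x ∘ (extChartAt 𝓘(ℝ, E) y).symm) e')).compContinuousLinearMap
        (fderiv ℝ (extChartAt 𝓘(ℝ, E) x ∘ (extChartAt 𝓘(ℝ, E) y).symm) e') := by
      filter_upwards [(isOpen_extChartAt_target y).mem_nhds hyt,
        (tendsto_extChartAt_symm y).eventually ((isOpen_extChartAt_source x).mem_nhds hyx)]
        with e' h1 h2
      exact chartRep_coordChange α h1 h2
    rw [h1.extDeriv_eq, extDeriv_pullback (r := ∞) (by rwa [hfe])
      (contDiffAt_coordChange hyt (by rwa [hyy])) minSmoothness_two_le, hfe,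
      fderiv_coordChange hyt (by rwa [hyy]), chartDSymm_self, hyy]
    rfl
  have h := chartD_comp_chartDSymm he
  change ContinuousAlternatingMap.compContinuousLinearMap (α.d.at y) _ = _
  rw [key]
  ext v
  change extDeriv (α.chartRep x) e _ = _
  congr 1
  funext i
  exact congrArg (fun L : E →L[ℝ] E ↦ L (v i)) h

/-- `d ∘ d = 0` at a point near which the form is smooth. -/
theorem d_d {α : FormField E M F n} {x : M}
    (hα : ContDiffAt ℝ ∞ (α.chartRep x) (extChartAt 𝓘(ℝ, E) x x)) : α.d.d x = 0 := by
  change α.d.d.at x = 0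
  rw [d_eq_extDeriv]
  -- Near `x` the inner derivative is defined with a chart that varies with the point; chart
  -- independence replaces all of them by the one at `x`.
  have h : α.d.chartRep x =ᶠ[𝓝 (extChartAt 𝓘(ℝ, E) x x)] extDeriv (α.chartRep x) := by
    filter_upwards [(isOpen_extChartAt_target x).mem_nhds (mem_extChartAt_target x),
      (hα.of_le (m := 1) (by norm_cast)).eventually (by simp)] with e h1 h2
    exact chartRep_d α h1 (h2.differentiableAt one_ne_zero)
  rw [h.extDeriv_eq]
  exact extDeriv_extDeriv_apply hα minSmoothness_two_le

-- In a fixed chart the exterior derivative is the alternatization, a continuous linear map, of the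
-- differentiable map `fderiv`.
set_option synthInstance.maxHeartbeats 200000 in
theorem differentiableAt_chartRep_d {α : FormField E M F n} {x : M}
    (hα : ContDiffAt ℝ ∞ (α.chartRep x) (extChartAt 𝓘(ℝ, E) x x)) :
    DifferentiableAt ℝ (α.d.chartRep x) (extChartAt 𝓘(ℝ, E) x x) := by
  have h : α.d.chartRep x =ᶠ[𝓝 (extChartAt 𝓘(ℝ, E) x x)] extDeriv (α.chartRep x) := by
    filter_upwards [(isOpen_extChartAt_target x).mem_nhds (mem_extChartAt_target x),
      (hα.of_le (m := 1) (by norm_cast)).eventually (by simp)] with e h1 h2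
    exact chartRep_d α h1 (h2.differentiableAt one_ne_zero)
  refine DifferentiableAt.congr_of_eventuallyEq ?_ h
  have h2 : DifferentiableAt ℝ (fderiv ℝ (α.chartRep x)) (extChartAt 𝓘(ℝ, E) x x) :=
    (hα.fderiv_right (m := 1) (by norm_num; norm_cast)).differentiableAt one_ne_zero
  exact ((ContinuousAlternatingMap.alternatizeUncurryFinCLM ℝ E F (n := n)).hasFDerivAt.comp _
    h2.hasFDerivAt).differentiableAt

/-- The exterior derivative of a function is its differential. -/
theorem d_ofFun (f : M → F) {x : M} (hf : MDifferentiableAt 𝓘(ℝ, E) 𝓘(ℝ, F) f x)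
    (v : Fin 1 → TangentSpace 𝓘(ℝ, E) x) :
    (ofFun E f).d x v = mfderiv 𝓘(ℝ, E) 𝓘(ℝ, F) f x (v 0) := by
  change (ofFun E f).d.at x v = _
  rw [d_eq_extDeriv]
  have h : (ofFun E f).chartRep x = fun e ↦
      ContinuousAlternatingMap.constOfIsEmpty ℝ E (Fin 0) (f ((extChartAt 𝓘(ℝ, E) x).symm e)) := by
    funext e; ext v; rfl
  rw [h, extDeriv_constOfIsEmpty]
  have h3 : mfderiv 𝓘(ℝ, E) 𝓘(ℝ, F) f x =
      fderiv ℝ (fun e ↦ f ((extChartAt 𝓘(ℝ, E) x).symm e)) (extChartAt 𝓘(ℝ, E) x x) := by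
    rw [hf.mfderiv]
    simp [writtenInExtChartAt, Function.comp_def]
    rfl
  rw [h3]
  rfl

end

end FormField

end HKTProof

/-! ### Endomorphism fields, vector fields and the metric in charts -/

noncomputable section HKTProof

open Set Filter Topology

variable {E : Type*} [NormedAddCommGroup E] [NormedSpace ℝ E]
  {M : Type*} [TopologicalSpace M] [ChartedSpace E M]
  {F : Type*} [NormedAddCommGroup F] [NormedSpace ℝ F]

/-- The value of an endomorphism field at a point, as an endomorphism of the model space. -/
def EndoField.at (J : EndoField E M) (x : M) : E →L[ℝ] E := J x

/-- The expression of an endomorphism field in the preferred chart at `x`. -/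
def EndoField.chartRep (J : EndoField E M) (x : M) : E → E →L[ℝ] E :=
  fun e ↦ chartD E x ((extChartAt 𝓘(ℝ, E) x).symm e) ∘L
    J.at ((extChartAt 𝓘(ℝ, E) x).symm e) ∘L chartDSymm x e

/-- The endomorphism field `J` is smooth. -/
def EndoField.IsSmooth [IsManifold 𝓘(ℝ, E) ∞ M] (J : EndoField E M) : Prop :=
  ContMDiff 𝓘(ℝ, E) (𝓘(ℝ, E).prod 𝓘(ℝ, E →L[ℝ] E)) ∞
    (fun x ↦ TotalSpace.mk' (E →L[ℝ] E)
      (E := fun x : M ↦ TangentSpace 𝓘(ℝ, E) x →L[ℝ] TangentSpace 𝓘(ℝ, E) x) x (J x))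

/-- The vector field which is constant in the preferred chart at `x`. -/
def constField (x : M) (v : E) : (y : M) → TangentSpace 𝓘(ℝ, E) y :=
  fun y ↦ chartDSymm x (extChartAt 𝓘(ℝ, E) x y) v

/-- The expression of a vector field in the preferred chart at `x`. -/
def fieldRep (s : (y : M) → TangentSpace 𝓘(ℝ, E) y) (x : M) : E → E :=
  fun e ↦ chartD E x ((extChartAt 𝓘(ℝ, E) x).symm e) (s ((extChartAt 𝓘(ℝ, E) x).symm e))

section

variable [IsManifold 𝓘(ℝ, E) ∞ M]

theorem constField_self (x : M) (v : E) : constField x v x = v := by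
  rw [constField, chartDSymm_self]; rfl

theorem EndoField.chartRep_self (J : EndoField E M) (x : M) :
    J.chartRep x (extChartAt 𝓘(ℝ, E) x x) = J.at x := by
  have h : (extChartAt 𝓘(ℝ, E) x).symm (extChartAt 𝓘(ℝ, E) x x) = x := extChartAt_to_inv x
  rw [chartRep, chartDSymm_self, h, chartD_self]
  rfl

theorem fieldRep_self (s : (y : M) → TangentSpace 𝓘(ℝ, E) y) (x : M) :
    fieldRep s x (extChartAt 𝓘(ℝ, E) x x) = s x := by
  have h : (extChartAt 𝓘(ℝ, E) x).symm (extChartAt 𝓘(ℝ, E) x x) = x := extChartAt_to_inv x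
  rw [fieldRep, h, chartD_self]
  rfl

theorem fieldRep_constField {x : M} (v : E) {e : E} (he : e ∈ (extChartAt 𝓘(ℝ, E) x).target) :
    fieldRep (constField x v) x e = v := by
  have h := congrArg (fun L : E →L[ℝ] E ↦ L v) (chartD_comp_chartDSymm he)
  have h2 := (extChartAt 𝓘(ℝ, E) x).right_inv he
  rw [fieldRep, constField, h2]
  exact h

omit [IsManifold 𝓘(ℝ, E) ∞ M] in
theorem fieldRep_endo_constField (J : EndoField E M) {x : M} (v : E) {e : E}
    (he : e ∈ (extChartAt 𝓘(ℝ, E) x).target) :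
    fieldRep (fun y ↦ J y (constField x v y)) x e = J.chartRep x e v := by
  have h2 := (extChartAt 𝓘(ℝ, E) x).right_inv he
  simp only [fieldRep, constField, h2]
  rfl

/-- This is the bridge from smoothness of sections of the tangent bundle to smoothness of their
chart expressions. -/
theorem trivializationAt_snd {x y : M} (hy : y ∈ (chartAt E x).source)
    (w : TangentSpace 𝓘(ℝ, E) y) :
    (trivializationAt E (TangentSpace 𝓘(ℝ, E) : M → Type _) x ⟨y, w⟩).2 = chartD E x y w := by
  have := isManifold_one (E := E) (M := M)
  have h := TangentBundle.continuousLinearMapAt_trivializationAt (I := 𝓘(ℝ, E)) (x₀ := x) hy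
  have h2 := congrFun ((trivializationAt E (TangentSpace 𝓘(ℝ, E) : M → Type _) x).coe_linearMapAt_of_mem
    (R := ℝ) (b := y) (by simpa using hy)) w
  exact h2.symm.trans (congrArg (fun L : TangentSpace 𝓘(ℝ, E) y →L[ℝ] E ↦ L w) h)

theorem contMDiffAt_constField (x : M) (v : E) :
    ContMDiffAt 𝓘(ℝ, E) 𝓘(ℝ, E).tangent ∞
      (fun y ↦ (constField x v y : TangentBundle 𝓘(ℝ, E) M)) x := by
  have := isManifold_one (E := E) (M := M)
  rw [contMDiffAt_section]
  refine (contMDiffAt_const (c := v)).congr_of_eventuallyEq ?_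
  filter_upwards [(chartAt E x).open_source.mem_nhds (mem_chart_source E x)] with y hy
  have hy' : y ∈ (extChartAt 𝓘(ℝ, E) x).source := by simpa using hy
  have h3 := fieldRep_constField (x := x) v ((extChartAt 𝓘(ℝ, E) x).map_source hy')
  rw [fieldRep, (extChartAt 𝓘(ℝ, E) x).left_inv hy'] at h3
  exact (trivializationAt_snd hy _).trans h3

theorem fieldDiffAt_constField (x : M) (v : E) : FieldDiffAt (constField x v) x :=
  (contMDiffAt_constField x v).mdifferentiableAt (by simp)

theorem EndoField.IsSmooth.fieldDiffAt_apply {J : EndoField E M} (hJ : J.IsSmooth)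
    {s : (y : M) → TangentSpace 𝓘(ℝ, E) y} {x : M} (hs : FieldDiffAt s x) :
    FieldDiffAt (fun y ↦ J y (s y)) x :=
  MDifferentiableAt.clm_bundle_apply ((hJ x).mdifferentiableAt (by simp)) hs

theorem contDiffAt_comp_extChartAt_symm {G : Type*} [NormedAddCommGroup G] [NormedSpace ℝ G]
    {f : M → G} {x : M} (hf : ContMDiffAt 𝓘(ℝ, E) 𝓘(ℝ, G) ∞ f x) :
    ContDiffAt ℝ ∞ (f ∘ (extChartAt 𝓘(ℝ, E) x).symm) (extChartAt 𝓘(ℝ, E) x x) := by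
  rw [← contMDiffAt_iff_contDiffAt]
  refine ContMDiffAt.comp _ (I' := 𝓘(ℝ, E)) (by rwa [extChartAt_to_inv]) ?_
  exact (contMDiffOn_extChartAt_symm x).contMDiffAt (extChartAt_target_mem_nhds x)

theorem EndoField.IsSmooth.contDiffAt_chartRep {J : EndoField E M} (hJ : J.IsSmooth) (x : M) :
    ContDiffAt ℝ ∞ (J.chartRep x) (extChartAt 𝓘(ℝ, E) x x) := by
  have := isManifold_one (E := E) (M := M)
  have h := ((contMDiffAt_hom_bundle _).1 (hJ x)).2
  refine (contDiffAt_comp_extChartAt_symm h).congr_of_eventuallyEq ?_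
  filter_upwards [extChartAt_target_mem_nhds (I := 𝓘(ℝ, E)) x] with e he
  have hs : (extChartAt 𝓘(ℝ, E) x).symm e ∈ (chartAt E x).source := by
    simpa using (extChartAt 𝓘(ℝ, E) x).map_target he
  have h3 := inTangentCoordinates_eq_mfderiv_comp (I := 𝓘(ℝ, E)) (I' := 𝓘(ℝ, E))
    (f := id) (g := id) (ϕ := J) (x₀ := x) hs hs
  rw [modelWithCornersSelf_coe, range_id, mfderivWithin_univ] at h3
  simp only [id] at h3
  rw [(extChartAt 𝓘(ℝ, E) x).right_inv he] at h3
  exact h3.symm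

theorem differentiableAt_fieldRep {s : (y : M) → TangentSpace 𝓘(ℝ, E) y} {x : M}
    (hs : FieldDiffAt s x) : DifferentiableAt ℝ (fieldRep s x) (extChartAt 𝓘(ℝ, E) x x) := by
  have := isManifold_one (E := E) (M := M)
  have h := (mdifferentiableAt_section _ _).1 hs
  have h2 : MDifferentiableAt 𝓘(ℝ, E) 𝓘(ℝ, E) (fun y ↦ chartD E x y (s y)) x := by
    refine h.congr_of_eventuallyEq ?_
    filter_upwards [(chartAt E x).open_source.mem_nhds (mem_chart_source E x)] with y hy
    exact (trivializationAt_snd hy _).symm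
  rw [← mdifferentiableAt_iff_differentiableAt]
  refine MDifferentiableAt.comp _ (I' := 𝓘(ℝ, E)) (g := fun y ↦ chartD E x y (s y))
    (by rwa [extChartAt_to_inv]) ?_
  exact mdifferentiableAt_extChartAt_symm (mem_extChartAt_target x)

/-- The value of the metric at a point, as a bilinear form on the model space. -/
def metricAt (g : RiemMetric E M) (x : M) : E →L[ℝ] E →L[ℝ] ℝ := g.inner x

/-- The expression of the metric in the preferred chart at `x`. -/
def metricRep (g : RiemMetric E M) (x : M) : E → E →L[ℝ] E →L[ℝ] ℝ :=
  fun e ↦ (metricAt g ((extChartAt 𝓘(ℝ, E) x).symm e)).bilinearComp (chartDSymm x e) (chartDSymm x e)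

theorem metricRep_self (g : RiemMetric E M) (x : M) :
    metricRep g x (extChartAt 𝓘(ℝ, E) x x) = metricAt g x := by
  have h : (extChartAt 𝓘(ℝ, E) x).symm (extChartAt 𝓘(ℝ, E) x x) = x := extChartAt_to_inv x
  rw [metricRep, chartDSymm_self, h]
  rfl

theorem metricRep_apply (g : RiemMetric E M) {x : M} {e : E}
    (he : e ∈ (extChartAt 𝓘(ℝ, E) x).target) (u v : E) :
    metricRep g x e u v =
      g.inner ((extChartAt 𝓘(ℝ, E) x).symm e) (constField x u ((extChartAt 𝓘(ℝ, E) x).symm e))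
        (constField x v ((extChartAt 𝓘(ℝ, E) x).symm e)) := by
  have h2 := (extChartAt 𝓘(ℝ, E) x).right_inv he
  simp only [constField, h2]
  rfl

theorem contMDiffAt_metric_apply (g : RiemMetric E M) {s t : (y : M) → TangentSpace 𝓘(ℝ, E) y} {x : M}
    (hs : ContMDiffAt 𝓘(ℝ, E) 𝓘(ℝ, E).tangent ∞ (fun y ↦ (s y : TangentBundle 𝓘(ℝ, E) M)) x)
    (ht : ContMDiffAt 𝓘(ℝ, E) 𝓘(ℝ, E).tangent ∞ (fun y ↦ (t y : TangentBundle 𝓘(ℝ, E) M)) x) :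
    ContMDiffAt 𝓘(ℝ, E) 𝓘(ℝ, ℝ) ∞ (fun y ↦ g.inner y (s y) (t y)) x := by
  have h := ContMDiffAt.clm_bundle_apply₂ (F₁ := E) (F₂ := E) (F₃ := ℝ) (E₃ := Bundle.Trivial M ℝ)
    (g.contMDiff x) hs ht
  have h := (contMDiffAt_section _).1 h
  exact h

/-- In finite dimension a linear map is determined linearly by its values on a basis. Applied twice,
this reduces smoothness of the metric to that of its components. -/
theorem contDiffAt_of_apply [FiniteDimensional ℝ E] {f : E → E →L[ℝ] F} {p : E}
    (h : ∀ v, ContDiffAt ℝ ∞ (fun e ↦ f e v) p) : ContDiffAt ℝ ∞ f p := by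
  have hd : Module.finrank ℝ E = Module.finrank ℝ (Fin (Module.finrank ℝ E) → ℝ) :=
    (Module.finrank_fin_fun ℝ).symm
  let e₁ := ContinuousLinearEquiv.ofFinrankEq hd
  let e₂ := (e₁.arrowCongr (1 : F ≃L[ℝ] F)).trans
    (ContinuousLinearEquiv.piRing (Fin (Module.finrank ℝ E)))
  rw [← Function.id_comp f, ← e₂.symm_comp_self]
  exact e₂.symm.contDiff.contDiffAt.comp p (contDiffAt_pi.mpr fun i ↦ h _)

theorem contDiffAt_metricRep [FiniteDimensional ℝ E] (g : RiemMetric E M) (x : M) :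
    ContDiffAt ℝ ∞ (metricRep g x) (extChartAt 𝓘(ℝ, E) x x) := by
  refine contDiffAt_of_apply fun u ↦ contDiffAt_of_apply fun v ↦ ?_
  refine (contDiffAt_comp_extChartAt_symm (contMDiffAt_metric_apply g (contMDiffAt_constField x u)
    (contMDiffAt_constField x v))).congr_of_eventuallyEq ?_
  filter_upwards [extChartAt_target_mem_nhds (I := 𝓘(ℝ, E)) x] with e he
  exact metricRep_apply g he u v

end

end HKTProof

/-! ### Christoffel symbols, torsion and integrability -/

noncomputable section HKTProof

open Set Filter Topology

variable {E : Type*} [NormedAddCommGroup E] [NormedSpace ℝ E]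
  {M : Type*} [TopologicalSpace M] [ChartedSpace E M]
  {F : Type*} [NormedAddCommGroup F] [NormedSpace ℝ F]
  [IsManifold 𝓘(ℝ, E) ∞ M]

omit [IsManifold 𝓘(ℝ, E) ∞ M] in
theorem mfderiv_eq_fderiv_chart {f : M → F} {x : M} (hf : MDifferentiableAt 𝓘(ℝ, E) 𝓘(ℝ, F) f x) :
    mfderiv 𝓘(ℝ, E) 𝓘(ℝ, F) f x =
      fderiv ℝ (f ∘ (extChartAt 𝓘(ℝ, E) x).symm) (extChartAt 𝓘(ℝ, E) x x) := by
  rw [hf.mfderiv]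
  simp [writtenInExtChartAt, Function.comp_def]
  rfl

theorem differentiableAt_comp_extChartAt_symm {f : M → F} {x : M}
    (hf : MDifferentiableAt 𝓘(ℝ, E) 𝓘(ℝ, F) f x) :
    DifferentiableAt ℝ (f ∘ (extChartAt 𝓘(ℝ, E) x).symm) (extChartAt 𝓘(ℝ, E) x x) := by
  rw [← mdifferentiableAt_iff_differentiableAt]
  refine MDifferentiableAt.comp _ (I' := 𝓘(ℝ, E)) (by rwa [extChartAt_to_inv]) ?_
  exact mdifferentiableAt_extChartAt_symm (mem_extChartAt_target x)

/-- The derivative of a vector field at `x` in the preferred chart at `x`, as an endomorphism of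
the model space. -/
def fieldDeriv (s : (y : M) → TangentSpace 𝓘(ℝ, E) y) (x : M) : E →L[ℝ] E :=
  fderiv ℝ (fieldRep s x) (extChartAt 𝓘(ℝ, E) x x)

/-- The derivative of a vector field at `x` in the preferred chart at `x`. -/
def chartCov (x : M) (s : (y : M) → TangentSpace 𝓘(ℝ, E) y) (y : M) :
    TangentSpace 𝓘(ℝ, E) y →L[ℝ] TangentSpace 𝓘(ℝ, E) y :=
  fieldDeriv (E := E) (M := M) s x

/-- The flat derivative of the chart serves as a reference connection at the single point `x`; the
difference from it is tensorial and defines the Christoffel symbols. -/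
theorem isCovariantDerivativeOn_chartCov (x : M) :
    IsCovariantDerivativeOn (I := 𝓘(ℝ, E)) E (chartCov x) {x} where
  add {σ σ' y} hσ hσ' hy := by
    obtain rfl : y = x := hy
    have h : fieldRep (σ + σ') y = fieldRep σ y + fieldRep σ' y := by
      funext e; exact map_add (chartD E y _) _ _
    unfold chartCov fieldDeriv
    rw [h]
    exact fderiv_add (differentiableAt_fieldRep hσ) (differentiableAt_fieldRep hσ')
  leibniz {σ g y} hσ hg hy := by
    obtain rfl : y = x := hy
    have h : fieldRep (g • σ) y =
        fun e ↦ (g ∘ (extChartAt 𝓘(ℝ, E) y).symm) e • fieldRep σ y e := by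
      funext e; exact map_smul (chartD E y _) _ _
    unfold chartCov fieldDeriv
    rw [h]
    refine (fderiv_fun_smul (differentiableAt_comp_extChartAt_symm hg)
      (differentiableAt_fieldRep hσ)).trans ?_
    rw [Function.comp_apply, extChartAt_to_inv, fieldRep_self, ← mfderiv_eq_fderiv_chart hg]
    rfl

variable [FiniteDimensional ℝ E]

/-- The Christoffel symbols at `x` of a connection in the preferred chart at `x`:
`christoffel cov x v w` is `∇_w V` where `V` is the constant vector field with value `v`. -/
def christoffel (cov : LinConnection E M) (x : M) : E →L[ℝ] E →L[ℝ] E :=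
  (cov.isCovariantDerivativeOn (s := {x})).difference (isCovariantDerivativeOn_chartCov x) x

/-- The covariant derivative at a point, as an endomorphism of the model space. -/
def covAt (cov : LinConnection E M) (s : (y : M) → TangentSpace 𝓘(ℝ, E) y) (x : M) : E →L[ℝ] E :=
  cov s x

theorem covAt_eq (cov : LinConnection E M) {x : M} {s : (y : M) → TangentSpace 𝓘(ℝ, E) y}
    (hs : FieldDiffAt s x) (w : E) :
    covAt cov s x w = fieldDeriv s x w + christoffel cov x (s x) w := by
  have h := IsCovariantDerivativeOn.difference_apply (cov.isCovariantDerivativeOn (s := {x}))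
    (isCovariantDerivativeOn_chartCov x) (x := x) rfl hs
  have h3 : christoffel cov x (s x) w = covAt cov s x w - fieldDeriv s x w :=
    congrArg (fun L : E →L[ℝ] E ↦ L w) h
  rw [h3, add_sub_cancel]

omit [FiniteDimensional ℝ E] in
theorem fieldDeriv_constField (x : M) (v : E) :
    fieldDeriv (constField x v) x = 0 := by
  have h : fieldRep (constField x v) x =ᶠ[𝓝 (extChartAt 𝓘(ℝ, E) x x)] fun _ ↦ v := by
    filter_upwards [extChartAt_target_mem_nhds (I := 𝓘(ℝ, E)) x] with e he
    exact fieldRep_constField v he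
  rw [fieldDeriv, h.fderiv_eq]; simp

theorem covAt_constField (cov : LinConnection E M) (x : M) (v w : E) :
    covAt cov (constField x v) x w = christoffel cov x v w := by
  rw [covAt_eq cov (fieldDiffAt_constField x v), fieldDeriv_constField, constField_self, 
    zero_apply, zero_add]

/-- Test parallelism on a field V constant in the chart: ∇_w (J V) is the derivative of J plus a
Christoffel term, while J ∇_w V is a Christoffel term only. -/
theorem IsParallel.fderiv_chartRep {cov : LinConnection E M} {J : EndoField E M}
    (h : IsParallel cov J) (hJ : J.IsSmooth) (x : M) (v w : E) :
    fderiv ℝ (J.chartRep x) (extChartAt 𝓘(ℝ, E) x x) w v =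
      J.at x (christoffel cov x v w) - christoffel cov x (J.at x v) w := by
  have h1 : covAt cov (fun y ↦ J y (constField x v y)) x w = J.at x (covAt cov (constField x v) x w) :=
    h x (constField x v) w (fieldDiffAt_constField x v)
  rw [covAt_eq cov (hJ.fieldDiffAt_apply (fieldDiffAt_constField x v)), covAt_constField,
    constField_self] at h1
  have h2 : fieldRep (fun y ↦ J y (constField x v y)) x =ᶠ[𝓝 (extChartAt 𝓘(ℝ, E) x x)]
      fun e ↦ J.chartRep x e v := by
    filter_upwards [extChartAt_target_mem_nhds (I := 𝓘(ℝ, E)) x] with e he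
    exact fieldRep_endo_constField J v he
  rw [fieldDeriv, h2.fderiv_eq, fderiv_clm_apply
    ((hJ.contDiffAt_chartRep x).differentiableAt (by simp)) (by fun_prop)] at h1
  have h3 : fderiv ℝ (J.chartRep x) (extChartAt 𝓘(ℝ, E) x x) w v + christoffel cov x (J.at x v) w =
      J.at x (christoffel cov x v w) := by
    simpa using! h1
  rw [← h3, add_sub_cancel_right]

theorem IsMetricConnection.fderiv_metricRep {g : RiemMetric E M} {cov : LinConnection E M}
    (h : IsMetricConnection g cov) (x : M) (u v w : E) :
    fderiv ℝ (metricRep g x) (extChartAt 𝓘(ℝ, E) x x) w u v =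
      metricAt g x (christoffel cov x u w) v + metricAt g x u (christoffel cov x v w) := by
  have hd : MDifferentiableAt 𝓘(ℝ, E) 𝓘(ℝ, ℝ)
      (fun y ↦ g.inner y (constField x u y) (constField x v y)) x :=
    (contMDiffAt_metric_apply g (contMDiffAt_constField x u)
      (contMDiffAt_constField x v)).mdifferentiableAt (by simp)
  have h1 : mfderiv 𝓘(ℝ, E) 𝓘(ℝ, ℝ) (fun y ↦ g.inner y (constField x u y) (constField x v y)) x w =
      metricAt g x (covAt cov (constField x u) x w) (constField x v x) +
        metricAt g x (constField x u x) (covAt cov (constField x v) x w) :=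
    h x (constField x u) (constField x v) w (fieldDiffAt_constField x u) (fieldDiffAt_constField x v)
  rw [mfderiv_eq_fderiv_chart hd, covAt_constField, covAt_constField, constField_self,
    constField_self] at h1
  have h2 : (fun y ↦ g.inner y (constField x u y) (constField x v y)) ∘ (extChartAt 𝓘(ℝ, E) x).symm
      =ᶠ[𝓝 (extChartAt 𝓘(ℝ, E) x x)] fun e ↦ metricRep g x e u v := by
    filter_upwards [extChartAt_target_mem_nhds (I := 𝓘(ℝ, E)) x] with e he
    exact (metricRep_apply g he u v).symm
  have hg := (contDiffAt_metricRep g x).differentiableAt (by simp)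
  rw [h2.fderiv_eq, fderiv_clm_apply (hg.clm_apply (by fun_prop)) (by fun_prop),
    fderiv_clm_apply hg (by fun_prop)] at h1
  simpa using! h1

omit [FiniteDimensional ℝ E] in
theorem lieBracketWithin_eq_zero {V W : E → E} {p u v : E} (hV : V =ᶠ[𝓝 p] fun _ ↦ u)
    (hW : W =ᶠ[𝓝 p] fun _ ↦ v) : VectorField.lieBracketWithin ℝ V W univ p = 0 := by
  rw [VectorField.lieBracketWithin_univ, hV.lieBracket_vectorField_eq hW]
  simp [VectorField.lieBracket]

variable [CompleteSpace E]

/-- The torsion at a point, as a bilinear map on the model space. -/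
def torsionAt (cov : LinConnection E M) (x : M) : E →L[ℝ] E →L[ℝ] E := cov.torsion x

omit [FiniteDimensional ℝ E] [CompleteSpace E] in
theorem mlieBracket_constField (x : M) (u v : E) :
    VectorField.mlieBracket 𝓘(ℝ, E) (constField x u) (constField x v) x = 0 := by
  have := isManifold_one (E := E) (M := M)
  rw [← VectorField.mlieBracketWithin_univ, VectorField.mlieBracketWithin_apply]
  have hc (w : E) : VectorField.mpullbackWithin 𝓘(ℝ, E) 𝓘(ℝ, E) (extChartAt 𝓘(ℝ, E) x).symm
      (constField x w) (range 𝓘(ℝ, E)) =ᶠ[𝓝 (extChartAt 𝓘(ℝ, E) x x)] fun _ ↦ w := by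
    filter_upwards [extChartAt_target_mem_nhds (I := 𝓘(ℝ, E)) x] with e he
    have hinv := isInvertible_mfderivWithin_extChartAt_symm (I := 𝓘(ℝ, E)) he
    rw [VectorField.mpullbackWithin_apply]
    have hw : constField x w ((extChartAt 𝓘(ℝ, E) x).symm e) =
        mfderivWithin 𝓘(ℝ, E) 𝓘(ℝ, E) (extChartAt 𝓘(ℝ, E) x).symm (range 𝓘(ℝ, E)) e w := by
      rw [constField, (extChartAt 𝓘(ℝ, E) x).right_inv he, modelWithCornersSelf_coe, range_id,
        mfderivWithin_univ]
      rfl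
    rw [hw]
    exact hinv.inverse_apply_eq.2 rfl
  have h0 : VectorField.lieBracketWithin ℝ
      (VectorField.mpullbackWithin 𝓘(ℝ, E) 𝓘(ℝ, E) (extChartAt 𝓘(ℝ, E) x).symm
        (constField x u) (range 𝓘(ℝ, E)))
      (VectorField.mpullbackWithin 𝓘(ℝ, E) 𝓘(ℝ, E) (extChartAt 𝓘(ℝ, E) x).symm
        (constField x v) (range 𝓘(ℝ, E))) univ (extChartAt 𝓘(ℝ, E) x x) = 0 := by
    exact lieBracketWithin_eq_zero (hc u) (hc v)
  have hs : (extChartAt 𝓘(ℝ, E) x).symm ⁻¹' (univ : Set M) ∩ range 𝓘(ℝ, E) = univ := by simp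
  rw [hs, h0]
  exact map_zero _

theorem torsionAt_apply (cov : LinConnection E M) {x : M} {A B : (y : M) → TangentSpace 𝓘(ℝ, E) y}
    (hA : FieldDiffAt A x) (hB : FieldDiffAt B x) {a b c : E} (ha : a = A x) (hb : b = B x)
    (hc : c = VectorField.mlieBracket 𝓘(ℝ, E) A B x) :
    torsionAt cov x a b = covAt cov B x a - covAt cov A x b - c := by
  rw [ha, hb, hc]; exact cov.torsion_apply hA hB

theorem torsionAt_eq (cov : LinConnection E M) (x : M) (u v : E) :
    torsionAt cov x u v = christoffel cov x v u - christoffel cov x u v := by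
  rw [torsionAt_apply cov (fieldDiffAt_constField x u) (fieldDiffAt_constField x v)
    (constField_self x u).symm (constField_self x v).symm (c := 0) (mlieBracket_constField x u v).symm,
    covAt_constField, covAt_constField, sub_zero]

/-- Substitute [A,B] = ∇_A B - ∇_B A - T(A,B) in the Nijenhuis tensor. Since J is parallel and J² =
-1, all covariant derivatives cancel and only torsion remains. -/
theorem IsComplexStructure.torsion_map_map {J : EndoField E M} (hJ : IsComplexStructure J)
    {cov : LinConnection E M} (h : IsParallel cov J) (x : M) (u v : E) :
    torsionAt cov x (J.at x u) (J.at x v) =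
      J.at x (torsionAt cov x (J.at x u) v) + J.at x (torsionAt cov x u (J.at x v)) +
        torsionAt cov x u v := by
  set U := constField x u with hU
  set V := constField x v with hV
  have hs : J.IsSmooth := hJ.smooth
  have dU : FieldDiffAt U x := fieldDiffAt_constField x u
  have dV : FieldDiffAt V x := fieldDiffAt_constField x v
  have dJU : FieldDiffAt (fun y ↦ J y (U y)) x := hs.fieldDiffAt_apply dU
  have dJV : FieldDiffAt (fun y ↦ J y (V y)) x := hs.fieldDiffAt_apply dV
  have hN := hJ.nijenhuis x U V (contMDiffAt_constField x u) (contMDiffAt_constField x v)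
  have eU : U x = u := constField_self x u
  have eV : V x = v := constField_self x v
  have hsq (w : E) : J.at x (J.at x w) = -w := hJ.sq x w
  obtain ⟨b₁, hb₁⟩ : ∃ b : E, b = VectorField.mlieBracket 𝓘(ℝ, E) (fun y ↦ J y (U y))
    (fun y ↦ J y (V y)) x := ⟨_, rfl⟩
  obtain ⟨b₂, hb₂⟩ : ∃ b : E, b = VectorField.mlieBracket 𝓘(ℝ, E) (fun y ↦ J y (U y)) V x := ⟨_, rfl⟩
  obtain ⟨b₃, hb₃⟩ : ∃ b : E, b = VectorField.mlieBracket 𝓘(ℝ, E) U (fun y ↦ J y (V y)) x := ⟨_, rfl⟩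
  obtain ⟨b₄, hb₄⟩ : ∃ b : E, b = VectorField.mlieBracket 𝓘(ℝ, E) U V x := ⟨_, rfl⟩
  have p (W : (y : M) → TangentSpace 𝓘(ℝ, E) y) (hW : FieldDiffAt W x) (w : E) :
      covAt cov (fun y ↦ J y (W y)) x w = J.at x (covAt cov W x w) := h x W w hW
  have t₁ := torsionAt_apply cov dJU dJV (a := J.at x u) (b := J.at x v) (by rw [eU]; rfl) (by rw [eV]; rfl) hb₁
  have t₂ := torsionAt_apply cov dJU dV (a := J.at x u) (b := v) (by rw [eU]; rfl) eV.symm hb₂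
  have t₃ := torsionAt_apply cov dU dJV (a := u) (b := J.at x v) eU.symm (by rw [eV]; rfl) hb₃
  have t₄ := torsionAt_apply cov dU dV (a := u) (b := v) eU.symm eV.symm hb₄
  have hN' : b₁ - J.at x b₂ - J.at x b₃ - b₄ = 0 := by
    rw [hb₁, hb₂, hb₃, hb₄]; exact hN
  rw [p V dV, p U dU] at t₁
  rw [p U dU] at t₂
  rw [p V dV] at t₃
  rw [t₁, t₂, t₃, t₄]
  simp only [map_sub, hsq]
  rw [← sub_eq_zero, ← neg_eq_zero, ← hN']
  abel

end HKTProof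

noncomputable section HKTProof

open Set Filter Topology

variable {E : Type*} [NormedAddCommGroup E] [NormedSpace ℝ E]
  {M : Type*} [TopologicalSpace M] [ChartedSpace E M]
  {F : Type*} [NormedAddCommGroup F] [NormedSpace ℝ F]
  {G : Type*} [NormedAddCommGroup G] [NormedSpace ℝ G]

/-! ### Exterior derivatives of low degree on the model space -/

section Flat

theorem hasFDerivAt_ofSubsingleton {β : E → E →L[ℝ] F} {p : E} (hβ : DifferentiableAt ℝ β p) :
    HasFDerivAt (fun e ↦ ContinuousAlternatingMap.ofSubsingleton ℝ E F (0 : Fin 1) (β e))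
      ((ContinuousAlternatingMap.ofSubsingletonLIE (𝕜 := ℝ) (E := E) (F := F) (0 : Fin 1)).toContinuousLinearEquiv.toContinuousLinearMap ∘L
        fderiv ℝ β p) p :=
  (ContinuousAlternatingMap.ofSubsingletonLIE (𝕜 := ℝ) (E := E) (F := F)
    (0 : Fin 1)).toContinuousLinearEquiv.toContinuousLinearMap.hasFDerivAt.comp p hβ.hasFDerivAt

theorem extDeriv_ofSubsingleton {β : E → E →L[ℝ] F} {p : E} (hβ : DifferentiableAt ℝ β p) (u v : E) :
    extDeriv (fun e ↦ ContinuousAlternatingMap.ofSubsingleton ℝ E F (0 : Fin 1) (β e)) p ![u, v] =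
      fderiv ℝ β p u v - fderiv ℝ β p v u := by
  rw [extDeriv, (hasFDerivAt_ofSubsingleton hβ).fderiv,
    ContinuousAlternatingMap.alternatizeUncurryFin_apply]
  simp [Fin.sum_univ_two, Fin.removeNth, sub_eq_add_neg]

theorem extDeriv_apply_three {η : E → E [⋀^Fin 2]→L[ℝ] F} {p : E} (hη : DifferentiableAt ℝ η p)
    (u v w : E) :
    extDeriv η p ![u, v, w] = fderiv ℝ (fun e ↦ η e ![v, w]) p u - fderiv ℝ (fun e ↦ η e ![u, w]) p v
      + fderiv ℝ (fun e ↦ η e ![u, v]) p w := by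
  rw [extDeriv_apply hη]
  have h0 : (0 : Fin 3).removeNth ![u, v, w] = ![v, w] := by
    funext i; fin_cases i <;> rfl
  have h1 : (1 : Fin 3).removeNth ![u, v, w] = ![u, w] := by
    funext i; fin_cases i <;> rfl
  have h2 : (2 : Fin 3).removeNth ![u, v, w] = ![u, v] := by
    funext i; fin_cases i <;> rfl
  rw [Fin.sum_univ_three, h0, h1, h2]
  simp [sub_eq_add_neg]

theorem map_swap_two (α : E [⋀^Fin 2]→L[ℝ] F) (u v : E) : α ![u, v] = -α ![v, u] := by
  have h : α (![v, u] ∘ Equiv.swap 0 1) = -α ![v, u] :=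
    α.toAlternatingMap.map_swap ![v, u] (i := 0) (j := 1) (by decide)
  rw [← h]
  congr 1
  funext i; fin_cases i <;> rfl

/-- Skew-symmetrization as a continuous linear map; it doubles a form that is already skew, so half
of it recovers a 2-form from its bilinear components, with their regularity. -/
theorem exists_skew_clm : ∃ Φ : (E →L[ℝ] E →L[ℝ] F) →L[ℝ] E [⋀^Fin 2]→L[ℝ] F,
    ∀ C u v, Φ C ![u, v] = C u v - C v u := by
  let L := (ContinuousAlternatingMap.ofSubsingletonLIE (𝕜 := ℝ) (E := E) (F := F)
    (0 : Fin 1)).toContinuousLinearEquiv.toContinuousLinearMap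
  refine ⟨(ContinuousAlternatingMap.alternatizeUncurryFinCLM ℝ E F (n := 1)) ∘L
      (ContinuousLinearMap.compL ℝ E (E →L[ℝ] F) (E [⋀^Fin 1]→L[ℝ] F) L), fun C u v ↦ ?_⟩
  change ContinuousAlternatingMap.alternatizeUncurryFin (L ∘L C) ![u, v] = _
  rw [ContinuousAlternatingMap.alternatizeUncurryFin_apply]
  simp [L, Fin.sum_univ_two, Fin.removeNth, sub_eq_add_neg]

set_option synthInstance.maxHeartbeats 200000 in
theorem differentiableAt_of_bilinear {η : E → E [⋀^Fin 2]→L[ℝ] F} {B : E → E →L[ℝ] E →L[ℝ] F} {p : E}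
    (h : ∀ᶠ e in 𝓝 p, ∀ u v, η e ![u, v] = B e u v) (hB : DifferentiableAt ℝ B p) :
    DifferentiableAt ℝ η p := by
  obtain ⟨Φ, hΦ⟩ := exists_skew_clm (E := E) (F := F)
  have h2 : DifferentiableAt ℝ (fun e ↦ (1 / 2 : ℝ) • Φ (B e)) p :=
    DifferentiableAt.fun_const_smul (Φ.differentiableAt.comp p hB) _
  refine h2.congr_of_eventuallyEq ?_
  filter_upwards [h] with e he
  ext w
  have hw : w = ![w 0, w 1] := by funext i; fin_cases i <;> rfl
  rw [hw]
  change _ = (1 / 2 : ℝ) • Φ (B e) ![w 0, w 1]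
  rw [hΦ, ← he, ← he, map_swap_two (η e) (w 1), sub_neg_eq_add, ← two_smul ℝ, smul_smul]
  norm_num

/-- Needed to write the complex forms of the hypothesis through real ones: d commutes with a
constant linear map of the values. -/
theorem extDeriv_compContinuousAlternatingMap {n : ℕ} (L : F →L[ℝ] G) {η : E → E [⋀^Fin n]→L[ℝ] F} {p : E}
    (hη : DifferentiableAt ℝ η p) :
    DifferentiableAt ℝ (fun e ↦ L.compContinuousAlternatingMap (η e)) p ∧
    extDeriv (fun e ↦ L.compContinuousAlternatingMap (η e)) p =
      L.compContinuousAlternatingMap (extDeriv η p) := by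
  have hd : DifferentiableAt ℝ (fun e ↦ L.compContinuousAlternatingMap (η e)) p :=
    ((ContinuousLinearMap.compContinuousAlternatingMapCLM ℝ E F G (Fin n) L).hasFDerivAt.comp p
      hη.hasFDerivAt).differentiableAt
  refine ⟨hd, ?_⟩
  ext v
  rw [extDeriv_apply hd, ContinuousLinearMap.compContinuousAlternatingMap_coe, Function.comp_apply,
    extDeriv_apply hη, map_sum]
  refine Finset.sum_congr rfl fun i _ ↦ ?_
  rw [map_zsmul]
  congr 1
  have h : HasFDerivAt (fun e ↦ η e (i.removeNth v)) _ p :=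
    (hη.continuousAlternatingMap_apply_const (i.removeNth v)).hasFDerivAt
  have h2 := (L.hasFDerivAt.comp p h).fderiv
  exact congrArg (fun A : E →L[ℝ] G ↦ A (v i)) h2

end Flat

/-! ### The twisted differentials in degrees zero, one and two -/

namespace FormField

theorem act_ofFun (J : EndoField E M) (f : M → F) : act J (ofFun E f) = ofFun E f := by
  funext x
  ext v
  change (-1 : ℝ) ^ 0 • f x = f x
  simp

theorem act_apply {n : ℕ} (J : EndoField E M) (α : FormField E M F n) (x : M) (v : Fin n → E) :
    (act J α).at x v = (-1 : ℝ) ^ n • α.at x (fun i ↦ J.at x (v i)) := rfl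

theorem dc_zero (J : EndoField E M) (α : FormField E M F 0) (h : act J α = α) :
    dc J α = act J α.d := by
  rw [dc, h, pow_zero, one_smul]

/-- The sign is (-1)¹ from the definition of d_J times (-1)² from the outer action on a 2-form; in
the next degree it is (-1)²(-1)³, again -1. -/
theorem dc_one (J : EndoField E M) (α : FormField E M F 1) (x : M) (u v : E) :
    (dc J α).at x ![u, v] = -(act J α).d.at x ![J.at x u, J.at x v] := by
  have h : (fun i ↦ J.at x (![u, v] i)) = ![J.at x u, J.at x v] := by
    funext i; fin_cases i <;> rfl
  have h2 : (dc J α).at x ![u, v] = (-1 : ℝ) ^ 1 • (act J (act J α).d).at x ![u, v] := rfl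
  rw [h2, act_apply, h]
  simp

theorem dc_two (J : EndoField E M) (α : FormField E M F 2) (x : M) (u v w : E) :
    (dc J α).at x ![u, v, w] = -(act J α).d.at x ![J.at x u, J.at x v, J.at x w] := by
  have h : (fun i ↦ J.at x (![u, v, w] i)) = ![J.at x u, J.at x v, J.at x w] := by
    funext i; fin_cases i <;> rfl
  have h2 : (dc J α).at x ![u, v, w] = (-1 : ℝ) ^ 2 • (act J (act J α).d).at x ![u, v, w] := rfl
  rw [h2, act_apply, h]
  simp [pow_succ]

theorem dc_ofFun (J : EndoField E M) (f : M → F) (x : M) (v : Fin 1 → E) :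
    (dc J (ofFun E f)).at x v = -(ofFun E f).d.at x (fun i ↦ J.at x (v i)) := by
  rw [dc_zero J _ (act_ofFun J f), act_apply]
  simp

/-- The two signs cancel: (J d_K f)(v) = df(KJv) = -df(Lv) = d_L f(v). -/
theorem act_dc_ofFun_of_mul_eq_neg {J K L : EndoField E M} (h : ∀ x v, K x (J x v) = -L x v) (f : M → F) :
    act J (dc K (ofFun E f)) = dc L (ofFun E f) := by
  funext x
  change (act J (dc K (ofFun E f))).at x = (dc L (ofFun E f)).at x
  ext v
  rw [act_apply, dc_ofFun, dc_ofFun]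
  have hv : (fun i ↦ K.at x (J.at x (v i))) = fun i ↦ -L.at x (v i) := by
    funext i; exact h x (v i)
  rw [hv]
  have := (ofFun E f).d.at x |>.map_smul_univ (fun _ ↦ (-1 : ℝ)) (fun i ↦ L.at x (v i))
  simp only [neg_smul, one_smul] at this
  rw [this]
  simp

theorem act_dc_ofFun_of_mul_eq {J K L : EndoField E M} (h : ∀ x v, K x (J x v) = L x v) (f : M → F) :
    act J (dc K (ofFun E f)) = -dc L (ofFun E f) := by
  funext x
  change (act J (dc K (ofFun E f))).at x = -(dc L (ofFun E f)).at x
  ext v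
  have hv : (fun i ↦ K.at x (J.at x (v i))) = fun i ↦ L.at x (v i) := by
    funext i; exact h x (v i)
  rw [act_apply, dc_ofFun, hv, ContinuousAlternatingMap.neg_apply, dc_ofFun]
  simp

section

variable [IsManifold 𝓘(ℝ, E) ∞ M]

theorem chartRep_act {n : ℕ} (J : EndoField E M) (α : FormField E M F n) {x : M} {e : E}
    (he : e ∈ (extChartAt 𝓘(ℝ, E) x).target) :
    (act J α).chartRep x e =
      (-1 : ℝ) ^ n • (α.chartRep x e).compContinuousLinearMap (J.chartRep x e) := by
  ext v
  have hx := (extChartAt 𝓘(ℝ, E) x).map_target he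
  have h := chartDSymm_comp_chartD hx
  rw [(extChartAt 𝓘(ℝ, E) x).right_inv he] at h
  change (-1 : ℝ) ^ n • α.at _ _ = (-1 : ℝ) ^ n • α.at _ _
  congr 2
  funext i
  exact (congrArg (fun L : E →L[ℝ] E ↦ L (J.at _ (chartDSymm x e (v i)))) h).symm

theorem chartRep_dc_ofFun {J : EndoField E M} {f : M → F} {x : M}
    (hf : ContMDiffAt 𝓘(ℝ, E) 𝓘(ℝ, F) ∞ f x) :
    (dc J (ofFun E f)).chartRep x =ᶠ[𝓝 (extChartAt 𝓘(ℝ, E) x x)] fun e ↦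
      ContinuousAlternatingMap.ofSubsingleton ℝ E F (0 : Fin 1)
        (-(fderiv ℝ (f ∘ (extChartAt 𝓘(ℝ, E) x).symm) e ∘L J.chartRep x e)) := by
  have h := contDiffAt_comp_extChartAt_symm hf
  filter_upwards [extChartAt_target_mem_nhds (I := 𝓘(ℝ, E)) x,
    (h.of_le (m := 1) (by norm_cast)).eventually (by simp)] with e he h2
  have h3 : (ofFun E f).chartRep x = fun e ↦
      ContinuousAlternatingMap.constOfIsEmpty ℝ E (Fin 0) ((f ∘ (extChartAt 𝓘(ℝ, E) x).symm) e) := by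
    funext e; ext v; rfl
  have h4 : DifferentiableAt ℝ ((ofFun E f).chartRep x) e := by
    rw [h3]
    exact ((ContinuousAlternatingMap.constOfIsEmptyLIE ℝ E F
      (Fin 0)).toContinuousLinearEquiv.toContinuousLinearMap.hasFDerivAt.comp e
      (h2.differentiableAt one_ne_zero).hasFDerivAt).differentiableAt
  rw [dc_zero J _ (act_ofFun J f), chartRep_act J _ he, chartRep_d _ he h4, h3,
    extDeriv_constOfIsEmpty]
  ext v
  simp

theorem contDiffAt_chartRep_dc_ofFun {J : EndoField E M} (hJ : J.IsSmooth) {f : M → F} {x : M}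
    (hf : ContMDiffAt 𝓘(ℝ, E) 𝓘(ℝ, F) ∞ f x) :
    ContDiffAt ℝ ∞ ((dc J (ofFun E f)).chartRep x) (extChartAt 𝓘(ℝ, E) x x) := by
  refine ContDiffAt.congr_of_eventuallyEq ?_ (chartRep_dc_ofFun hf)
  have h := (contDiffAt_comp_extChartAt_symm hf).fderiv_right (m := ∞) (by simp)
  have h2 := (h.clm_comp (hJ.contDiffAt_chartRep x)).neg
  exact (ContinuousAlternatingMap.ofSubsingletonLIE (𝕜 := ℝ) (E := E) (F := F)
    (0 : Fin 1)).toContinuousLinearEquiv.toContinuousLinearMap.contDiff.contDiffAt.comp _ h2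

end

end FormField

end HKTProof

/-! ### The covariant Hessian and d d_J of a function -/

noncomputable section HKTProof

open Set Filter Topology

variable {E : Type*} [NormedAddCommGroup E] [NormedSpace ℝ E]
  {M : Type*} [TopologicalSpace M] [ChartedSpace E M]
  [IsManifold 𝓘(ℝ, E) ∞ M] [FiniteDimensional ℝ E]

/-- The differential of a function at a point, as a linear form on the model space. -/
def diffAt (f : M → ℝ) (x : M) : E →L[ℝ] ℝ :=
  fderiv ℝ (f ∘ (extChartAt 𝓘(ℝ, E) x).symm) (extChartAt 𝓘(ℝ, E) x x)

/-- The second covariant derivative of a function at a point. -/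
def hessian (cov : LinConnection E M) (f : M → ℝ) (x : M) : E →L[ℝ] E →L[ℝ] ℝ :=
  fderiv ℝ (fderiv ℝ (f ∘ (extChartAt 𝓘(ℝ, E) x).symm)) (extChartAt 𝓘(ℝ, E) x x) -
    (ContinuousLinearMap.compL ℝ E E ℝ (diffAt f x)) ∘L (christoffel cov x).flip

theorem hessian_apply (cov : LinConnection E M) (f : M → ℝ) (x : M) (u v : E) :
    hessian cov f x u v =
      fderiv ℝ (fderiv ℝ (f ∘ (extChartAt 𝓘(ℝ, E) x).symm)) (extChartAt 𝓘(ℝ, E) x x) u v -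
        diffAt f x (christoffel cov x v u) := rfl

/-- Differentiate d_J f = -df ∘ J in the chart. The derivative of J gives df(J Γ) - df(Γ J); the
second term completes the Hessian, and the first alternates to the torsion. -/
theorem d_dc_ofFun_apply [CompleteSpace E] {cov : LinConnection E M} {J : EndoField E M} (hJ : J.IsSmooth)
    (h : IsParallel cov J) {f : M → ℝ} {x : M} (hf : ContMDiffAt 𝓘(ℝ, E) 𝓘(ℝ, ℝ) ∞ f x) (u v : E) :
    (FormField.dc J (FormField.ofFun E f)).d.at x ![u, v] =
      -hessian cov f x u (J.at x v) + hessian cov f x v (J.at x u)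
        - diffAt f x (J.at x (torsionAt cov x u v)) := by
  rw [FormField.d_eq_extDeriv, (FormField.chartRep_dc_ofFun hf).extDeriv_eq]
  have h1 : DifferentiableAt ℝ (fderiv ℝ (f ∘ (extChartAt 𝓘(ℝ, E) x).symm))
      (extChartAt 𝓘(ℝ, E) x x) :=
    ((contDiffAt_comp_extChartAt_symm hf).fderiv_right (m := 1) (by norm_cast)).differentiableAt
      one_ne_zero
  have h2 := (hJ.contDiffAt_chartRep x).differentiableAt (n := ∞) (by simp)
  have h3 (a b : E) : fderiv ℝ (fun e ↦ -(fderiv ℝ (f ∘ (extChartAt 𝓘(ℝ, E) x).symm) e ∘L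
      J.chartRep x e)) (extChartAt 𝓘(ℝ, E) x x) a b =
      -(hessian cov f x a (J.at x b) + diffAt f x (J.at x (christoffel cov x b a))) := by
    rw [((h1.hasFDerivAt.clm_comp h2.hasFDerivAt).fun_neg).fderiv, hessian_apply]
    change -(diffAt f x (fderiv ℝ (J.chartRep x) (extChartAt 𝓘(ℝ, E) x x) a b) +
      fderiv ℝ (fderiv ℝ (f ∘ (extChartAt 𝓘(ℝ, E) x).symm)) (extChartAt 𝓘(ℝ, E) x x) a
        (J.chartRep x (extChartAt 𝓘(ℝ, E) x x) b)) = _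
    rw [h.fderiv_chartRep hJ, map_sub, J.chartRep_self]
    ring
  rw [extDeriv_ofSubsingleton (h1.clm_comp h2).fun_neg, h3, h3, torsionAt_eq, map_sub, map_sub]
  ring

/-- Ordinary second derivatives are symmetric, so only the skew part of the Christoffel symbols
survives. -/
theorem hessian_sub_swap [CompleteSpace E] (cov : LinConnection E M) {f : M → ℝ} {x : M}
    (hf : ContMDiffAt 𝓘(ℝ, E) 𝓘(ℝ, ℝ) ∞ f x) (u v : E) :
    hessian cov f x u v - hessian cov f x v u = -diffAt f x (torsionAt cov x u v) := by
  have h : IsSymmSndFDerivAt ℝ (f ∘ (extChartAt 𝓘(ℝ, E) x).symm) (extChartAt 𝓘(ℝ, E) x x) :=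
    (contDiffAt_comp_extChartAt_symm hf).isSymmSndFDerivAt minSmoothness_two_le
  rw [hessian_apply, hessian_apply, h.eq u v, torsionAt_eq, map_sub]
  ring

/-! ### The Kähler forms and the torsion -/

section Kahler

variable {g : RiemMetric E M} {J : EndoField E M} (hJ : IsHermitian g J)

omit [FiniteDimensional ℝ E] in
theorem kahlerForm_apply (x : M) (u v : E) :
    (kahlerForm g J hJ).at x ![u, v] = metricAt g x (J.at x u) v := rfl

omit [FiniteDimensional ℝ E] in
theorem act_kahlerForm : FormField.act J (kahlerForm g J hJ) = kahlerForm g J hJ := by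
  funext x
  change (FormField.act J (kahlerForm g J hJ)).at x = (kahlerForm g J hJ).at x
  ext v
  rw [FormField.act_apply]
  have h := hJ.inner_map x (J x (v 0)) (v 1)
  simp only [even_two, Even.neg_pow, one_pow, one_smul]
  exact h

omit [FiniteDimensional ℝ E] in
theorem chartRep_kahlerForm {x : M} {e : E} (he : e ∈ (extChartAt 𝓘(ℝ, E) x).target) (u v : E) :
    (kahlerForm g J hJ).chartRep x e ![u, v] = metricRep g x e (J.chartRep x e u) v := by
  have hx := (extChartAt 𝓘(ℝ, E) x).map_target he
  have h := chartDSymm_comp_chartD hx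
  rw [(extChartAt 𝓘(ℝ, E) x).right_inv he] at h
  change metricAt g _ _ _ = metricAt g _ _ _
  congr 2
  exact (congrArg (fun L : E →L[ℝ] E ↦ L (J.at _ (chartDSymm x e u))) h).symm

theorem differentiableAt_metricRep_comp (hs : J.IsSmooth) (x : M) :
    DifferentiableAt ℝ (fun e ↦ metricRep g x e ∘L J.chartRep x e) (extChartAt 𝓘(ℝ, E) x x) :=
  ((contDiffAt_metricRep g x).clm_comp (hs.contDiffAt_chartRep x)).differentiableAt (by simp)

theorem differentiableAt_chartRep_kahlerForm (hs : J.IsSmooth) (x : M) :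
    DifferentiableAt ℝ ((kahlerForm g J hJ).chartRep x) (extChartAt 𝓘(ℝ, E) x x) := by
  refine differentiableAt_of_bilinear (B := fun e ↦ metricRep g x e ∘L J.chartRep x e) ?_
    (differentiableAt_metricRep_comp hs x)
  filter_upwards [extChartAt_target_mem_nhds (I := 𝓘(ℝ, E)) x] with e he u v
  exact chartRep_kahlerForm hJ he u v

/-- This is ∇F = 0 in coordinates: the terms g(Γ J v, w) from the metric and from J cancel. -/
theorem fderiv_chartRep_kahlerForm {cov : LinConnection E M} (hs : J.IsSmooth)
    (hg : IsMetricConnection g cov) (hp : IsParallel cov J) (x : M) (u v w : E) :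
    fderiv ℝ (fun e ↦ (kahlerForm g J hJ).chartRep x e ![v, w]) (extChartAt 𝓘(ℝ, E) x x) u =
      metricAt g x (J.at x (christoffel cov x v u)) w +
        metricAt g x (J.at x v) (christoffel cov x w u) := by
  have h : (fun e ↦ (kahlerForm g J hJ).chartRep x e ![v, w]) =ᶠ[𝓝 (extChartAt 𝓘(ℝ, E) x x)]
      fun e ↦ metricRep g x e (J.chartRep x e v) w := by
    filter_upwards [extChartAt_target_mem_nhds (I := 𝓘(ℝ, E)) x] with e he
    exact chartRep_kahlerForm hJ he v w
  have h1 := ((contDiffAt_metricRep g x).differentiableAt (by simp)).hasFDerivAt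
  have h2 := ((hs.contDiffAt_chartRep x).differentiableAt (by simp)).hasFDerivAt
  have h3 := (h1.clm_apply (h2.clm_apply (hasFDerivAt_const v _))).clm_apply (hasFDerivAt_const w _)
  rw [h.fderiv_eq, h3.fderiv]
  rw [metricRep_self, J.chartRep_self]
  change metricAt g x (J.at x v) 0 + (metricAt g x (J.at x 0 + fderiv ℝ (J.chartRep x) _ u v) w +
    fderiv ℝ (metricRep g x) _ u (J.at x v) w) = _
  rw [hp.fderiv_chartRep hs, hg.fderiv_metricRep, map_zero, map_zero, zero_add, zero_add, map_sub,
    sub_apply]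
  ring

variable [CompleteSpace E]

/-- Since F is parallel, dF is the cyclic sum of g(J T(u,v), w). Evaluated on JX, JY, JZ it is the
cyclic sum of c(Z,JX,JY), which equals c(X,Y,Z) by integrability and total skewness. -/
theorem dc_kahlerForm_apply {I₁ I₂ I₃ : EndoField E M} {cov : LinConnection E M}
    (h : IsHKTConnection g I₁ I₂ I₃ cov) (hJc : IsComplexStructure J) (hp : IsParallel cov J)
    (x : M) (X Y Z : E) :
    (FormField.dc J (kahlerForm g J hJ)).at x ![X, Y, Z] = -torsionTensor g cov x X Y Z := by
  have hs : J.IsSmooth := hJc.smooth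
  have hd (u v w : E) : (kahlerForm g J hJ).d.at x ![u, v, w] =
      metricAt g x (J.at x (torsionAt cov x u v)) w + metricAt g x (J.at x (torsionAt cov x v w)) u +
        metricAt g x (J.at x (torsionAt cov x w u)) v := by
    rw [FormField.d_eq_extDeriv,
      extDeriv_apply_three (differentiableAt_chartRep_kahlerForm hJ hs x),
      fderiv_chartRep_kahlerForm hJ hs h.metric hp, fderiv_chartRep_kahlerForm hJ hs h.metric hp,
      fderiv_chartRep_kahlerForm hJ hs h.metric hp]
    have hsk (a b : E) : metricAt g x (J.at x a) b = -metricAt g x (J.at x b) a := by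
      rw [← kahlerForm_apply hJ, map_swap_two, kahlerForm_apply]
    simp only [torsionAt_eq, map_sub, sub_apply]
    rw [hsk v, hsk u (christoffel cov x w v), hsk u (christoffel cov x v w)]
    ring
  have hc (A B C : E) : torsionTensor g cov x A B C = metricAt g x (torsionAt cov x B C) A :=
    g.symm x A _
  have hi (A B : E) : metricAt g x (J.at x A) (J.at x B) = metricAt g x A B := hJ.inner_map x A B
  have hsq (A : E) : J.at x (J.at x A) = -A := hJ.sq x A
  have hJ' (A B : E) : metricAt g x (J.at x A) B = -metricAt g x A (J.at x B) := by
    rw [← hi A (J.at x B), hsq, map_neg, neg_neg]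
  -- Paired with Z, and with J moved across the metric, the integrability identity reads c(Z,JX,JY)
  -- = -c(JZ,JX,Y) - c(JZ,X,JY) + c(Z,X,Y).
  have hN := congrArg (fun A ↦ metricAt g x A Z) (hJc.torsion_map_map hp x X Y)
  simp only [map_add, add_apply, hJ'] at hN
  rw [← hc, ← hc, ← hc, ← hc] at hN
  rw [FormField.dc_two, act_kahlerForm, hd, hi, hi, hi, ← hc, ← hc, ← hc]
  have s12 (A B C : E) : torsionTensor g cov x A B C = -torsionTensor g cov x B A C := h.skew₁₂ x A B C
  have s23 (A B C : E) : torsionTensor g cov x A B C = -torsionTensor g cov x A C B := h.skew₂₃ x A B C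
  linarith [s23 (J.at x Z) (J.at x X) Y, s12 (J.at x Z) Y (J.at x X), s12 (J.at x Z) X (J.at x Y),
    s23 X (J.at x Z) (J.at x Y), s12 Z X Y, s23 X Z Y]

end Kahler

end HKTProof

noncomputable section HKTProof

open Set Filter Topology

/-! ### Linear algebra of quaternionic torsion -/

section LinearAlgebra

variable {E : Type*} [NormedAddCommGroup E] [NormedSpace ℝ E]

/-- Pointwise quaternionic relations and the vanishing of the Nijenhuis tensors, in terms of a
torsion `T`. -/
structure QuaternionicTorsion (I J K : E →L[ℝ] E) (T : E →L[ℝ] E →L[ℝ] E) : Prop where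
  sq₁ : ∀ v, I (I v) = -v
  sq₂ : ∀ v, J (J v) = -v
  sq₃ : ∀ v, K (K v) = -v
  mul₁₂ : ∀ v, I (J v) = K v
  mul₂₁ : ∀ v, J (I v) = -K v
  map_map₁ : ∀ u v, T (I u) (I v) = I (T (I u) v) + I (T u (I v)) + T u v
  map_map₂ : ∀ u v, T (J u) (J v) = J (T (J u) v) + J (T u (J v)) + T u v
  map_map₃ : ∀ u v, T (K u) (K v) = K (T (K u) v) + K (T u (K v)) + T u v

namespace QuaternionicTorsion

variable {I J K : E →L[ℝ] E} {T : E →L[ℝ] E →L[ℝ] E}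

theorem mul₂₃ (h : QuaternionicTorsion I J K T) (v : E) : J (K v) = I v := by
  have h1 := h.mul₂₁ (J v)
  rw [h.mul₁₂, ← h.mul₁₂ (J v), h.sq₂, map_neg, neg_neg] at h1
  exact h1

theorem mul₃₁ (h : QuaternionicTorsion I J K T) (v : E) : K (I v) = J v := by
  have h1 := h.mul₂₁ (I v)
  rw [h.sq₁, map_neg] at h1
  exact (neg_injective h1).symm

/-- This is the vanishing of the mixed Nijenhuis bracket of J and K, which follows from the three
unmixed ones. The identities for K at (X, IY), J at (JX, KY) and J applied to that of I at (JX, IY)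
are combined so that the terms containing IY cancel. -/
theorem mixed (h : QuaternionicTorsion I J K T) (X Y : E) :
    T (K X) (J Y) + T (J X) (K Y) =
      J (T (K X) Y) + J (T X (K Y)) + (K (T (J X) Y) + K (T X (J Y))) := by
  have h3 := h.map_map₃ X (I Y)
  have h2 := h.map_map₂ (J X) (K Y)
  have h1 := congrArg J (h.map_map₁ (J X) (I Y))
  simp only [h.sq₁, h.sq₂, h.mul₁₂, h.mul₂₃, h.mul₃₁, h.mul₂₁, map_neg, map_add,
    neg_apply] at h1 h2 h3
  linear_combination (norm := module) h3 - h2 + h1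

theorem map_map₂' (h : QuaternionicTorsion I J K T) (X Y : E) :
    I (T (J X) (J Y)) = K (T (J X) Y) + K (T X (J Y)) + I (T X Y) := by
  rw [h.map_map₂, map_add, map_add, h.mul₁₂, h.mul₁₂]

/-- The derivative of the twisted differential, in terms of the Hessian and the torsion. -/
def twisted (T : E →L[ℝ] E →L[ℝ] E) (H : E →L[ℝ] E →L[ℝ] ℝ) (l : E →L[ℝ] ℝ) (L : E →L[ℝ] E)
    (u v : E) : ℝ :=
  -H u (L v) + H v (L u) - l (L (T u v))

variable {H : E →L[ℝ] E →L[ℝ] ℝ} {l : E →L[ℝ] ℝ}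

/-- The form d d_L μ is of type (1,1) for L: the skew parts of the Hessian that appear are exactly
the torsion terms of the integrability identity. -/
theorem twisted_map_map {L : E →L[ℝ] E} (hsq : ∀ v, L (L v) = -v)
    (hL : ∀ u v, T (L u) (L v) = L (T (L u) v) + L (T u (L v)) + T u v)
    (hH : ∀ u v, H u v - H v u = -l (T u v)) (u v : E) :
    twisted T H l L (L u) (L v) = twisted T H l L u v := by
  have h1 := congrArg l (congrArg L (hL u v))
  simp only [map_add, hsq, map_neg] at h1
  simp only [twisted, hsq, map_neg]
  linarith [hH (L u) v, hH u (L v)]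

/-- After JK = I and IJ = K, the Hessian terms differ only by the order of arguments, leaving
l(T(KX,JY) + T(JX,KY)); `mixed` and `map_map₂'` then cancel all the torsion. -/
theorem twisted_add (h : QuaternionicTorsion I J K T) (hH : ∀ u v, H u v - H v u = -l (T u v))
    (X Y : E) :
    twisted T H l J (K X) Y + twisted T H l J X (K Y) =
      twisted T H l I X Y - twisted T H l I (J X) (J Y) := by
  have h1 := congrArg l (h.mixed X Y)
  have h2 := congrArg l (h.map_map₂' X Y)
  simp only [map_add] at h1 h2
  simp only [twisted, h.mul₂₃, h.mul₁₂]
  linarith [hH (K X) (J Y), hH (J X) (K Y)]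

end QuaternionicTorsion

end LinearAlgebra

variable {E : Type*} [NormedAddCommGroup E] [NormedSpace ℝ E]
  {M : Type*} [TopologicalSpace M] [ChartedSpace E M]
  {F : Type*} [NormedAddCommGroup F] [NormedSpace ℝ F]
  {G : Type*} [NormedAddCommGroup G] [NormedSpace ℝ G]
  [IsManifold 𝓘(ℝ, E) ∞ M]

/-! ### Change of the space of values -/

namespace FormField

/-- The composition of a form with a linear map between the spaces of values. -/
def postcomp {n : ℕ} (L : F →L[ℝ] G) (α : FormField E M F n) : FormField E M G n :=
  fun x ↦ L.compContinuousAlternatingMap (α x)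

theorem d_postcomp_add {n : ℕ} (L K : F →L[ℝ] G) {α β : FormField E M F n} {x : M}
    (hα : DifferentiableAt ℝ (α.chartRep x) (extChartAt 𝓘(ℝ, E) x x))
    (hβ : DifferentiableAt ℝ (β.chartRep x) (extChartAt 𝓘(ℝ, E) x x)) :
    (postcomp L α + postcomp K β).d x = (postcomp L α.d + postcomp K β.d) x := by
  have h1 := extDeriv_compContinuousAlternatingMap L hα
  have h2 := extDeriv_compContinuousAlternatingMap K hβ
  refine (d_add (α := postcomp L α) (β := postcomp K β) h1.1 h2.1).trans ?_
  change (postcomp L α).d.at x + (postcomp K β).d.at x =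
    L.compContinuousAlternatingMap (α.d.at x) + K.compContinuousAlternatingMap (β.d.at x)
  simp only [d_eq_extDeriv]
  exact congrArg₂ _ h1.2 h2.2

theorem dc_ofFun_comp (L : F →L[ℝ] G) (J : EndoField E M) {f : M → F} {x : M}
    (hf : MDifferentiableAt 𝓘(ℝ, E) 𝓘(ℝ, F) f x) :
    dc J (ofFun E (fun y ↦ L (f y))) x = postcomp L (dc J (ofFun E f)) x := by
  have hL : MDifferentiableAt 𝓘(ℝ, F) 𝓘(ℝ, G) L (f x) := L.differentiableAt.mdifferentiableAt
  have h1 : mfderiv 𝓘(ℝ, E) 𝓘(ℝ, G) (fun y ↦ L (f y)) x = L ∘L mfderiv 𝓘(ℝ, E) 𝓘(ℝ, F) f x := by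
    refine (mfderiv_comp (g := L) (f := f) x hL hf).trans ?_
    rw [mfderiv_eq_fderiv, L.fderiv]
    rfl
  have h2 : MDifferentiableAt 𝓘(ℝ, E) 𝓘(ℝ, G) (fun y ↦ L (f y)) x := hL.comp x hf
  change (dc J (ofFun E (fun y ↦ L (f y)))).at x =
    L.compContinuousAlternatingMap ((dc J (ofFun E f)).at x)
  ext v
  rw [ContinuousLinearMap.compContinuousAlternatingMap_coe, Function.comp_apply, dc_ofFun, dc_ofFun,
    map_neg]
  refine congrArg Neg.neg ?_
  refine (d_ofFun _ h2 _).trans ?_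
  rw [h1]
  exact (congrArg L (d_ofFun f hf (fun i ↦ J.at x (v i)))).symm

omit [IsManifold 𝓘(ℝ, E) ∞ M] in
theorem at_apply_two {α β : FormField E M F 2} {x : M}
    (h : ∀ u v : E, α.at x ![u, v] = β.at x ![u, v]) : α x = β x := by
  change α.at x = β.at x
  ext v
  have hv : v = ![v 0, v 1] := by funext i; fin_cases i <;> rfl
  rw [hv]; exact h _ _

omit [IsManifold 𝓘(ℝ, E) ∞ M] in
theorem at_apply_three {α β : FormField E M F 3} {x : M}
    (h : ∀ u v w : E, α.at x ![u, v, w] = β.at x ![u, v, w]) : α x = β x := by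
  change α.at x = β.at x
  ext v
  have hv : v = ![v 0, v 1, v 2] := by funext i; fin_cases i <;> rfl
  rw [hv]; exact h _ _ _

end FormField

end HKTProof

/-! ### From the complex equation to the potential -/

noncomputable section HKTProof

open Set Filter Topology

variable {E : Type*} [NormedAddCommGroup E] [NormedSpace ℝ E]
  {M : Type*} [TopologicalSpace M] [ChartedSpace E M]
  [IsManifold 𝓘(ℝ, E) ∞ M]
  {g : RiemMetric E M} {I₁ I₂ I₃ : EndoField E M} {x : M}

namespace IsHypercomplex

variable (hI : IsHypercomplex I₁ I₂ I₃)

include hI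

theorem mul₁₃ (x : M) (v : TangentSpace 𝓘(ℝ, E) x) : I₁ x (I₃ x v) = -I₂ x v := by
  rw [← hI.mul₁₂, hI.complex₁.sq]

theorem mul₃₂ (x : M) (v : TangentSpace 𝓘(ℝ, E) x) : I₃ x (I₂ x v) = -I₁ x v := by
  rw [← hI.mul₁₂, hI.complex₂.sq, map_neg]

theorem mul₃₁ (x : M) (v : TangentSpace 𝓘(ℝ, E) x) : I₃ x (I₁ x v) = I₂ x v := by
  have h1 := hI.mul₂₁ x (I₁ x v)
  rw [hI.complex₁.sq, map_neg] at h1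
  exact (neg_injective h1).symm

end IsHypercomplex

theorem quaternionicTorsion [FiniteDimensional ℝ E] [CompleteSpace E] {cov : LinConnection E M}
    (hI : IsHypercomplex I₁ I₂ I₃) (hc : IsHKTConnection g I₁ I₂ I₃ cov) (x : M) :
    QuaternionicTorsion (I₁.at x) (I₂.at x) (I₃.at x) (torsionAt cov x) where
  sq₁ := hI.complex₁.sq x
  sq₂ := hI.complex₂.sq x
  sq₃ := hI.complex₃.sq x
  mul₁₂ := hI.mul₁₂ x
  mul₂₁ := hI.mul₂₁ x
  map_map₁ := hI.complex₁.torsion_map_map hc.parallel₁ x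
  map_map₂ := hI.complex₂.torsion_map_map hc.parallel₂ x
  map_map₃ := hI.complex₃.torsion_map_map hc.parallel₃ x

namespace FormField

omit [IsManifold 𝓘(ℝ, E) ∞ M] in
theorem act_apply_two {F : Type*} [NormedAddCommGroup F] [NormedSpace ℝ F] (J : EndoField E M)
    (α : FormField E M F 2) (x : M) (u v : E) :
    (act J α).at x ![u, v] = α.at x ![J.at x u, J.at x v] := by
  have h : (fun i ↦ J.at x (![u, v] i)) = ![J.at x u, J.at x v] := by
    funext i; fin_cases i <;> rfl
  rw [act_apply, h, even_two.neg_one_pow, one_smul]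

-- The inner action turns d_K f into d_L f, so every mixed derivative d_J d_K f is expressed through
-- d d_L f alone.
omit [IsManifold 𝓘(ℝ, E) ∞ M] in
theorem dc_dc_ofFun_apply {J K L : EndoField E M} (h : ∀ x v, K x (J x v) = -L x v) (f : M → ℝ)
    (x : M) (u v : E) :
    (dc J (dc K (ofFun E f))).at x ![u, v] =
      -(dc L (ofFun E f)).d.at x ![J.at x u, J.at x v] := by
  rw [dc_one, act_dc_ofFun_of_mul_eq_neg h]

end FormField

open FormField

omit [IsManifold 𝓘(ℝ, E) ∞ M] in
theorem act_smul_complex {n : ℕ} (J : EndoField E M) (c : ℂ) (α : FormField E M ℂ n) :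
    act J (c • α) = c • act J α := by
  funext x
  ext v
  exact smul_comm ((-1 : ℝ) ^ n) c (α.at x fun i ↦ J.at x (v i))

omit [IsManifold 𝓘(ℝ, E) ∞ M] in
theorem act_add {n : ℕ} (J : EndoField E M) (α β : FormField E M ℂ n) :
    act J (α + β) = act J α + act J β := by
  funext x
  ext v
  exact smul_add ((-1 : ℝ) ^ n) (α.at x fun i ↦ J.at x (v i)) (β.at x fun i ↦ J.at x (v i))

/-- The map `t ↦ c t` from the reals to the complex numbers. -/
def realMul (c : ℂ) : ℝ →L[ℝ] ℂ := c • Complex.ofRealCLM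

section Complex

variable (hI : IsHypercomplex I₁ I₂ I₃)

include hI

/-- I_2 sends df to d_2 f and, as I_1 I_2 = I_3, sends d_1 f to -d_3 f. -/
theorem act_delBar_ofFun (f : M → ℂ) :
    act I₂ (delBar I₁ (ofFun E f)) =
      (1 / 2 : ℂ) • (dc I₂ (ofFun E f) + Complex.I • dc I₃ (ofFun E f)) := by
  rw [delBar, act_smul_complex, sub_eq_add_neg, ← neg_smul, act_add, act_smul_complex,
    act_dc_ofFun_of_mul_eq hI.mul₁₂, ← dc_zero I₂ _ (act_ofFun I₂ f), neg_smul_neg]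

theorem act_act_delBar_ofFun (f : M → ℂ) :
    act I₁ (act I₂ (delBar I₁ (ofFun E f))) =
      (1 / 2 : ℂ) • (dc I₃ (ofFun E f) - Complex.I • dc I₂ (ofFun E f)) := by
  rw [act_delBar_ofFun hI, act_smul_complex, act_add, act_smul_complex,
    act_dc_ofFun_of_mul_eq_neg hI.mul₂₁, act_dc_ofFun_of_mul_eq hI.mul₃₁, smul_neg, sub_eq_add_neg]

/-- The point is the separation into real and imaginary parts: I_1 takes d_2 μ + i d_3 μ to d_3 μ -
i d_2 μ, so the factor i in ∂_1 puts each I_1-rotated term back with its own unrotated one. -/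
theorem del_act_delBar_ofFun_apply {μ : M → ℝ} {x : M}
    (hμ : ∀ᶠ y in 𝓝 x, ContMDiffAt 𝓘(ℝ, E) 𝓘(ℝ, ℝ) ∞ μ y) (u v : E) :
    ((2 : ℂ) • del I₁ (act I₂ (delBar I₁ (ofFun E (fun y ↦ (μ y : ℂ)))))).at x ![u, v] =
      (((1 / 2 : ℝ) * ((dc I₂ (ofFun E μ)).d.at x ![u, v] -
        (dc I₂ (ofFun E μ)).d.at x ![I₁.at x u, I₁.at x v]) : ℝ) : ℂ) +
      Complex.I * (((1 / 2 : ℝ) * ((dc I₃ (ofFun E μ)).d.at x ![u, v] -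
        (dc I₃ (ofFun E μ)).d.at x ![I₁.at x u, I₁.at x v]) : ℝ) : ℂ) := by
  have hx := hμ.self_of_nhds
  have h2 := (contDiffAt_chartRep_dc_ofFun (E := E) hI.complex₂.smooth hx).differentiableAt (n := ∞) (by simp)
  have h3 := (contDiffAt_chartRep_dc_ofFun (E := E) hI.complex₃.smooth hx).differentiableAt (n := ∞) (by simp)
  have hC (J : EndoField E M) {y : M} (hy : ContMDiffAt 𝓘(ℝ, E) 𝓘(ℝ, ℝ) ∞ μ y) :
      dc J (ofFun E (fun y ↦ (μ y : ℂ))) y = postcomp Complex.ofRealCLM (dc J (ofFun E μ)) y :=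
    dc_ofFun_comp Complex.ofRealCLM J (hy.mdifferentiableAt (by simp))
  have e1 : (act I₂ (delBar I₁ (ofFun E (fun y ↦ (μ y : ℂ))))).d x =
      (postcomp (realMul (1 / 2)) (dc I₂ (ofFun E μ)).d +
        postcomp (realMul (Complex.I / 2)) (dc I₃ (ofFun E μ)).d) x := by
    rw [← d_postcomp_add _ _ h2 h3, act_delBar_ofFun hI]
    refine d_congr ?_
    filter_upwards [hμ] with y hy
    rw [Pi.smul_apply, Pi.add_apply, Pi.smul_apply, hC _ hy, hC _ hy]
    ext w
    change (1 / 2 : ℂ) * (((dc I₂ (ofFun E μ) y w : ℝ) : ℂ) +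
      Complex.I * ((dc I₃ (ofFun E μ) y w : ℝ) : ℂ)) =
      (1 / 2) * ((dc I₂ (ofFun E μ) y w : ℝ) : ℂ) +
      (Complex.I / 2) * ((dc I₃ (ofFun E μ) y w : ℝ) : ℂ)
    ring
  have e2 : (act I₁ (act I₂ (delBar I₁ (ofFun E (fun y ↦ (μ y : ℂ)))))).d x =
      (postcomp (realMul (1 / 2)) (dc I₃ (ofFun E μ)).d +
        postcomp (realMul (-Complex.I / 2)) (dc I₂ (ofFun E μ)).d) x := by
    rw [← d_postcomp_add _ _ h3 h2, act_act_delBar_ofFun hI]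
    refine d_congr ?_
    filter_upwards [hμ] with y hy
    rw [Pi.smul_apply, Pi.sub_apply, Pi.smul_apply, hC _ hy, hC _ hy]
    ext w
    change (1 / 2 : ℂ) * (((dc I₃ (ofFun E μ) y w : ℝ) : ℂ) -
      Complex.I * ((dc I₂ (ofFun E μ) y w : ℝ) : ℂ)) =
      (1 / 2) * ((dc I₃ (ofFun E μ) y w : ℝ) : ℂ) +
      (-Complex.I / 2) * ((dc I₂ (ofFun E μ) y w : ℝ) : ℂ)
    ring
  have e1' := congrArg (fun α : E [⋀^Fin 2]→L[ℝ] ℂ ↦ α ![u, v]) e1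
  have e2' := congrArg (fun α : E [⋀^Fin 2]→L[ℝ] ℂ ↦ α ![I₁.at x u, I₁.at x v]) e2
  have e1'' : (act I₂ (delBar I₁ (ofFun E (fun y ↦ (μ y : ℂ))))).d.at x ![u, v] =
      (1 / 2 : ℂ) * (((dc I₂ (ofFun E μ)).d.at x ![u, v] : ℝ) : ℂ) +
      (Complex.I / 2) * (((dc I₃ (ofFun E μ)).d.at x ![u, v] : ℝ) : ℂ) := e1'
  have e2'' : (act I₁ (act I₂ (delBar I₁ (ofFun E (fun y ↦ (μ y : ℂ)))))).d.at x
        ![I₁.at x u, I₁.at x v] =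
      (1 / 2 : ℂ) * (((dc I₃ (ofFun E μ)).d.at x ![I₁.at x u, I₁.at x v] : ℝ) : ℂ) +
      (-Complex.I / 2) * (((dc I₂ (ofFun E μ)).d.at x ![I₁.at x u, I₁.at x v] : ℝ) : ℂ) := e2'
  change (2 : ℂ) * ((1 / 2 : ℂ) * ((act I₂ (delBar I₁ (ofFun E (fun y ↦ (μ y : ℂ))))).d.at x ![u, v] +
    Complex.I * (dc I₁ (act I₂ (delBar I₁ (ofFun E (fun y ↦ (μ y : ℂ)))))).at x ![u, v])) = _
  rw [dc_one, e1'', e2'']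
  push_cast
  -- The only use of i² = -1 is on the rotated d d_2 μ term.
  linear_combination (-(1 / 2 : ℂ) * -(((dc I₂ (ofFun E μ)).d.at x ![I₁.at x u, I₁.at x v] : ℝ) : ℂ)) * Complex.I_mul_I

end Complex

variable [FiniteDimensional ℝ E] [CompleteSpace E] (h : IsHKT g I₁ I₂ I₃)
  {μ : M → ℝ}

section Potential

variable (hμ : ∀ᶠ y in 𝓝 x, ContMDiffAt 𝓘(ℝ, E) 𝓘(ℝ, ℝ) ∞ μ y)
    (heq : ((kahlerForm g I₂ h.hermitian₂).toComplex
          + Complex.I • (kahlerForm g I₃ h.hermitian₃).toComplex) x =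
        ((2 : ℂ) • FormField.del I₁ (FormField.act I₂
          (FormField.delBar I₁ (FormField.ofFun E (fun y ↦ (μ y : ℂ)))))) x)

include hμ heq

theorem kahlerForm_re_im (u v : E) :
    (kahlerForm g I₂ h.hermitian₂).at x ![u, v] =
      (1 / 2 : ℝ) * ((dc I₂ (ofFun E μ)).d.at x ![u, v] -
        (dc I₂ (ofFun E μ)).d.at x ![I₁.at x u, I₁.at x v]) ∧
    (kahlerForm g I₃ h.hermitian₃).at x ![u, v] =
      (1 / 2 : ℝ) * ((dc I₃ (ofFun E μ)).d.at x ![u, v] -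
        (dc I₃ (ofFun E μ)).d.at x ![I₁.at x u, I₁.at x v]) := by
  have h1 := congrArg (fun α : E [⋀^Fin 2]→L[ℝ] ℂ ↦ α ![u, v]) heq
  have h2 := h1.trans (del_act_delBar_ofFun_apply h.toIsHypercomplex hμ u v)
  have h3 : (((kahlerForm g I₂ h.hermitian₂).at x ![u, v] : ℝ) : ℂ) +
      Complex.I * (((kahlerForm g I₃ h.hermitian₃).at x ![u, v] : ℝ) : ℂ) = _ := h2
  constructor
  · simpa using congrArg Complex.re h3
  · simpa using congrArg Complex.im h3

theorem kahlerForm_potential {cov : LinConnection E M} (hc : IsHKTConnection g I₁ I₂ I₃ cov)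
    (u v : E) :
    (kahlerForm g I₁ h.hermitian₁).at x ![u, v] =
      (1 / 2 : ℝ) * ((dc I₁ (ofFun E μ)).d.at x ![u, v] +
        (dc I₂ (dc I₃ (ofFun E μ))).at x ![u, v]) ∧
    (kahlerForm g I₂ h.hermitian₂).at x ![u, v] =
      (1 / 2 : ℝ) * ((dc I₂ (ofFun E μ)).d.at x ![u, v] +
        (dc I₃ (dc I₁ (ofFun E μ))).at x ![u, v]) ∧
    (kahlerForm g I₃ h.hermitian₃).at x ![u, v] =
      (1 / 2 : ℝ) * ((dc I₃ (ofFun E μ)).d.at x ![u, v] +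
        (dc I₁ (dc I₂ (ofFun E μ))).at x ![u, v]) := by
  have hx := hμ.self_of_nhds
  have hI := h.toIsHypercomplex
  have hq := quaternionicTorsion hI hc x
  have hH := hessian_sub_swap cov hx
  have hB₁ (a b : E) : (dc I₁ (ofFun E μ)).d.at x ![a, b] =
      QuaternionicTorsion.twisted (torsionAt cov x) (hessian cov μ x) (diffAt μ x) (I₁.at x) a b :=
    d_dc_ofFun_apply hI.complex₁.smooth hc.parallel₁ hx a b
  have hB₂ (a b : E) : (dc I₂ (ofFun E μ)).d.at x ![a, b] =
      QuaternionicTorsion.twisted (torsionAt cov x) (hessian cov μ x) (diffAt μ x) (I₂.at x) a b :=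
    d_dc_ofFun_apply hI.complex₂.smooth hc.parallel₂ hx a b
  -- Rotate by I_2, which preserves d d_2 μ, and use I_2 I_1 = -I_3; the two signs cancel.
  have hi₂ (a b : E) : (dc I₂ (ofFun E μ)).d.at x ![I₁.at x a, I₁.at x b] =
      (dc I₂ (ofFun E μ)).d.at x ![I₃.at x a, I₃.at x b] := by
    rw [hB₂, hB₂, ← QuaternionicTorsion.twisted_map_map hq.sq₂ hq.map_map₂ hH, hq.mul₂₁, hq.mul₂₁]
    simp [QuaternionicTorsion.twisted]
  have hk := kahlerForm_re_im h hμ heq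
  refine ⟨?_, ?_, ?_⟩
  -- Since I_2 I_3 = I_1, the form F_1 is obtained from the known F_2; I_3² = -1 then produces the
  -- symmetric left side of `twisted_add`.
  · have h1 : (kahlerForm g I₁ h.hermitian₁).at x ![u, v] =
        (kahlerForm g I₂ h.hermitian₂).at x ![I₃.at x u, v] := by
      rw [kahlerForm_apply, kahlerForm_apply, hq.mul₂₃]
    rw [h1, (hk _ _).1, hi₂, dc_dc_ofFun_apply hI.mul₃₂, hB₁, hB₁, hB₂, hB₂, hq.sq₃]
    have h2 := hq.twisted_add hH u v
    have h3 : QuaternionicTorsion.twisted (torsionAt cov x) (hessian cov μ x) (diffAt μ x)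
        (I₂.at x) (-u) (I₃.at x v) = -QuaternionicTorsion.twisted (torsionAt cov x)
          (hessian cov μ x) (diffAt μ x) (I₂.at x) u (I₃.at x v) := by
      simp only [QuaternionicTorsion.twisted, map_neg, neg_apply]
      ring
    rw [h3]
    linarith
  · rw [(hk u v).1, dc_dc_ofFun_apply hI.mul₁₃, hi₂]
    ring
  · rw [(hk u v).2, dc_dc_ofFun_apply hI.mul₂₁]
    ring

end Potential

theorem act_d_dc_ofFun (hI : IsHypercomplex I₁ I₂ I₃) {cov : LinConnection E M}
    (hc : IsHKTConnection g I₁ I₂ I₃ cov)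
    (hμ : ContMDiffAt 𝓘(ℝ, E) 𝓘(ℝ, ℝ) ∞ μ x) :
    act I₁ (dc I₁ (ofFun E μ)).d x = (dc I₁ (ofFun E μ)).d x := by
  have hq := quaternionicTorsion hI hc x
  refine at_apply_two fun u v ↦ ?_
  have hB₁ (a b : E) : (dc I₁ (ofFun E μ)).d.at x ![a, b] =
      QuaternionicTorsion.twisted (torsionAt cov x) (hessian cov μ x) (diffAt μ x) (I₁.at x) a b :=
    d_dc_ofFun_apply hI.complex₁.smooth hc.parallel₁ hμ a b
  rw [act_apply_two, hB₁, hB₁, QuaternionicTorsion.twisted_map_map hq.sq₁ hq.map_map₁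
    (hessian_sub_swap cov hμ)]

/-- Both F_1 and d d_1 μ are I_1-invariant, so I_1 d_2 d_3 μ = 2 F_1 - d d_1 μ and d d = 0 removes
the last term. The formula for F_1 is needed on a neighbourhood because it is differentiated. -/
theorem dc_dc_dc_ofFun_apply {cov : LinConnection E M} (hc : IsHKTConnection g I₁ I₂ I₃ cov)
    (hμ : ∀ᶠ y in 𝓝 x, ContMDiffAt 𝓘(ℝ, E) 𝓘(ℝ, ℝ) ∞ μ y)
    (hF : ∀ᶠ y in 𝓝 x, kahlerForm g I₁ h.hermitian₁ y =
      (1 / 2 : ℝ) • ((dc I₁ (ofFun E μ)).d + dc I₂ (dc I₃ (ofFun E μ))) y) (u v w : E) :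
    (dc I₁ (dc I₂ (dc I₃ (ofFun E μ)))).at x ![u, v, w] =
      2 * (dc I₁ (kahlerForm g I₁ h.hermitian₁)).at x ![u, v, w] := by
  have hs := contDiffAt_chartRep_dc_ofFun (E := E) h.complex₁.smooth hμ.self_of_nhds
  have h1 : ∀ᶠ y in 𝓝 x, act I₁ (dc I₂ (dc I₃ (ofFun E μ))) y =
      ((2 : ℝ) • kahlerForm g I₁ h.hermitian₁ + (-1 : ℝ) • (dc I₁ (ofFun E μ)).d) y := by
    filter_upwards [hF, hμ] with y hy hμy
    have h2 := act_d_dc_ofFun h.toIsHypercomplex hc hμy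
    have h3 : act I₁ (kahlerForm g I₁ h.hermitian₁) y = kahlerForm g I₁ h.hermitian₁ y := by
      rw [act_kahlerForm]
    refine at_apply_two fun a b ↦ ?_
    have e (a b : E) : (kahlerForm g I₁ h.hermitian₁).at y ![a, b] = (1 / 2 : ℝ) *
        ((dc I₁ (ofFun E μ)).d.at y ![a, b] + (dc I₂ (dc I₃ (ofFun E μ))).at y ![a, b]) :=
      congrArg (fun α : E [⋀^Fin 2]→L[ℝ] ℝ ↦ α ![a, b]) hy
    have e2 : (act I₁ (dc I₁ (ofFun E μ)).d).at y ![a, b] = (dc I₁ (ofFun E μ)).d.at y ![a, b] :=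
      congrArg (fun α : E [⋀^Fin 2]→L[ℝ] ℝ ↦ α ![a, b]) h2
    have e3 : (act I₁ (kahlerForm g I₁ h.hermitian₁)).at y ![a, b] =
        (kahlerForm g I₁ h.hermitian₁).at y ![a, b] :=
      congrArg (fun α : E [⋀^Fin 2]→L[ℝ] ℝ ↦ α ![a, b]) h3
    change _ = (2 : ℝ) * (kahlerForm g I₁ h.hermitian₁).at y ![a, b] +
      (-1 : ℝ) * (dc I₁ (ofFun E μ)).d.at y ![a, b]
    rw [act_apply_two] at e2 e3 ⊢
    linarith [e (I₁.at y a) (I₁.at y b)]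
  have hk := differentiableAt_chartRep_kahlerForm h.hermitian₁ h.complex₁.smooth x
  have h5 : (act I₁ (dc I₂ (dc I₃ (ofFun E μ)))).d x =
      ((2 : ℝ) • (kahlerForm g I₁ h.hermitian₁).d) x := by
    rw [d_congr h1, d_add (hk.const_smul (2 : ℝ)) ((differentiableAt_chartRep_d hs).const_smul (-1 : ℝ)),
      d_smul, d_smul, d_d hs, smul_zero, add_zero, Pi.smul_apply]
  have h6 : (act I₁ (dc I₂ (dc I₃ (ofFun E μ)))).d.at x ![I₁.at x u, I₁.at x v, I₁.at x w] =
      2 * (kahlerForm g I₁ h.hermitian₁).d.at x ![I₁.at x u, I₁.at x v, I₁.at x w] :=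
    congrArg (fun α : E [⋀^Fin 3]→L[ℝ] ℝ ↦ α ![I₁.at x u, I₁.at x v, I₁.at x w]) h5
  rw [dc_two, dc_two, act_kahlerForm, h6]
  ring

end HKTProof

/-! ### The theorem -/

theorem mainTheorem9
    {E : Type*} [NormedAddCommGroup E] [NormedSpace ℝ E] [FiniteDimensional ℝ E] [CompleteSpace E]
    {M : Type*} [TopologicalSpace M] [ChartedSpace E M] [IsManifold 𝓘(ℝ, E) ∞ M]
    (g : RiemMetric E M) (I₁ I₂ I₃ : EndoField E M) (h : IsHKT g I₁ I₂ I₃)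
    (U : Set M) (hU : IsOpen U) (μ : M → ℝ) (hμ : ContMDiffOn 𝓘(ℝ, E) 𝓘(ℝ, ℝ) ∞ μ U)
    (heq : ∀ x ∈ U,
      ((kahlerForm g I₂ h.hermitian₂).toComplex
          + Complex.I • (kahlerForm g I₃ h.hermitian₃).toComplex) x =
        ((2 : ℂ) • FormField.del I₁ (FormField.act I₂
          (FormField.delBar I₁ (FormField.ofFun E (fun y ↦ (μ y : ℂ)))))) x) :
    IsHKTPotentialOn g I₁ I₂ I₃ h U μ ∧
    (∀ x ∈ U,
      FormField.dc I₁ (kahlerForm g I₁ h.hermitian₁) x =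
        (1 / 2 : ℝ) • FormField.dc I₁ (FormField.dc I₂ (FormField.dc I₃ (FormField.ofFun E μ))) x ∧
      FormField.dc I₂ (kahlerForm g I₂ h.hermitian₂) x =
        (1 / 2 : ℝ) • FormField.dc I₁ (FormField.dc I₂ (FormField.dc I₃ (FormField.ofFun E μ))) x ∧
      FormField.dc I₃ (kahlerForm g I₃ h.hermitian₃) x =
        (1 / 2 : ℝ) • FormField.dc I₁ (FormField.dc I₂ (FormField.dc I₃ (FormField.ofFun E μ))) x) ∧
    (∀ cov : LinConnection E M, IsHKTConnection g I₁ I₂ I₃ cov →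
      ∀ x ∈ U, ∀ X Y Z : TangentSpace 𝓘(ℝ, E) x,
        torsionTensor g cov x X Y Z =
          -(1 / 2 : ℝ) *
            FormField.dc I₁ (FormField.dc I₂ (FormField.dc I₃ (FormField.ofFun E μ))) x
              ![X, Y, Z]) := by
  have hnhds {x : M} (hx : x ∈ U) :
      ∀ᶠ y in nhds x, ContMDiffAt 𝓘(ℝ, E) 𝓘(ℝ, ℝ) ∞ μ y := by
    filter_upwards [hU.mem_nhds hx] with y hy
    exact hμ.contMDiffAt (hU.mem_nhds hy)
  obtain ⟨cov₀, hc₀⟩ := h.exists_connection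
  have hpot : IsHKTPotentialOn g I₁ I₂ I₃ h U μ := by
    intro x hx
    have hp := kahlerForm_potential h (hnhds hx) (heq x hx) hc₀
    refine ⟨?_, ?_, ?_⟩
    · exact FormField.at_apply_two (β := (1 / 2 : ℝ) • ((FormField.dc I₁ (FormField.ofFun E μ)).d +
        FormField.dc I₂ (FormField.dc I₃ (FormField.ofFun E μ)))) fun u v ↦ (hp u v).1
    · exact FormField.at_apply_two (β := (1 / 2 : ℝ) • ((FormField.dc I₂ (FormField.ofFun E μ)).d +
        FormField.dc I₃ (FormField.dc I₁ (FormField.ofFun E μ)))) fun u v ↦ (hp u v).2.1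
    · exact FormField.at_apply_two (β := (1 / 2 : ℝ) • ((FormField.dc I₃ (FormField.ofFun E μ)).d +
        FormField.dc I₁ (FormField.dc I₂ (FormField.ofFun E μ)))) fun u v ↦ (hp u v).2.2
  -- The potential formulas do not mention a connection; once obtained from `cov₀` they give the
  -- torsion of an arbitrary HKT-connection.
  have hddd {cov : LinConnection E M} (hc : IsHKTConnection g I₁ I₂ I₃ cov) {x : M} (hx : x ∈ U)
      (u v w : E) : (FormField.dc I₁ (FormField.dc I₂ (FormField.dc I₃
        (FormField.ofFun E μ)))).at x ![u, v, w] = 2 * -torsionTensor g cov x u v w := by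
    rw [dc_dc_dc_ofFun_apply h hc (hnhds hx), dc_kahlerForm_apply h.hermitian₁ hc h.complex₁ hc.parallel₁]
    filter_upwards [hU.mem_nhds hx] with y hy
    exact (hpot y hy).1
  have hdc {J : EndoField E M} (hJ : IsHermitian g J) (hJc : IsComplexStructure J)
      (hp : IsParallel cov₀ J) {x : M} (hx : x ∈ U) : FormField.dc J (kahlerForm g J hJ) x =
        (1 / 2 : ℝ) • FormField.dc I₁ (FormField.dc I₂ (FormField.dc I₃
          (FormField.ofFun E μ))) x := by
    refine FormField.at_apply_three (β := (1 / 2 : ℝ) • FormField.dc I₁ (FormField.dc I₂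
      (FormField.dc I₃ (FormField.ofFun E μ)))) fun u v w ↦ ?_
    change _ = (1 / 2 : ℝ) * (FormField.dc I₁ (FormField.dc I₂ (FormField.dc I₃
      (FormField.ofFun E μ)))).at x ![u, v, w]
    rw [dc_kahlerForm_apply hJ hc₀ hJc hp, hddd hc₀ hx]
    ring
  refine ⟨hpot, fun x hx ↦ ⟨hdc _ h.complex₁ hc₀.parallel₁ hx, hdc _ h.complex₂ hc₀.parallel₂ hx,
    hdc _ h.complex₃ hc₀.parallel₃ hx⟩, fun cov hc x hx X Y Z ↦ ?_⟩
  have h1 := hddd hc hx X Y Z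
  change _ = -(1 / 2 : ℝ) * (FormField.dc I₁ (FormField.dc I₂ (FormField.dc I₃
    (FormField.ofFun E μ)))).at x ![X, Y, Z]
  rw [h1]
  ring
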